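/- **Setting.** For a differentiable $g:\mathbb R^d\times\mathbb R^d\to\mathbb R$ let $F_g(z)=(\nabla_x g(x,y),-\nabla_y g(x,y))$, $z=(x,y)\in\mathbb R^{2d}$. Call $g$ *$L$-smooth* if $\|F_g(z_1)-F_g(z_2)\|\le L\|z_1-z_2\|$, and *$\mu$-strongly-convex-strongly-concave* if $\langle F_g(z_1)-F_g(z_2),z_1-z_2\rangle\ge\mu\|z_1-z_2\|^2$, for all $z_1,z_2\in\mathbb R^{2d}$. Twice differentiable functions $f_1,\dots,f_M$ with average $f=\frac1M\sum_m f_m$ are *$\delta$-related* if at every $(x,y)$ and for every $m$ each of $\nabla^2_{xx}f_m-\nabla^2_{xx}f$, $\nabla^2_{xy}f_m-\nabla^2_{xy}f$, $\nabla^2_{yy}f_m-\nabla^2_{yy}f$ has operator norm at most $\delta$. A *gossip matrix* of a connected undirected graph $\mathcal G$ on $\{1,\dots,M\}$, $M\ge2$, is a symmetric $W\in\mathbb R^{M\times M}$ with $W\mathbf 1=\mathbf 1$, $w_{ii}>0$, $w_{ij}>0$ if $\{i,j\}$ is an edge, and $w_{ij}=0$ for all other $i\ne j$. Its *eigengap*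 is $1-\max\{\lambda_2(W),|\lambda_{\min}(W)|\}$, with eigenvalues $\lambda_1\ge\lambda_2\ge\dots\ge\lambda_M=\lambda_{\min}$. *Decentralized algorithms.* Every agent $m$ has memories $\mathcal M^x_m,\mathcal M^y_m\subseteq\mathbb R^d$, initially $\{0\}$. * *Local computation.* Between communication rounds each agent $m$ adds finitely many points, one pair after another, $x$ to $\mathcal M_m^x$ and $y$ to $\mathcal M_m^y$, where for some $\alpha,\beta,\theta,\varphi\ge0$ with $\alpha+\beta>0$, $\theta+\varphi>0$: the vector $\alpha x+\beta\nabla_xf_m(x,y)$ lies in the span of the vectors $u$, $(\nabla^2_{xx}f_m(x'',y'')+D)u$, $(\nabla^2_{xx}f_m(x'',y'')+D)^{-1}u$ with $u\in\{x',\nabla_xf_m(x',y')\}$ and $\nabla^2_{xy}f_m(x'',y'')v$ with $v\in\{y',\nabla_yf_m(x',y')\}$; and $\theta y-\varphi\nabla_yf_m(x,y)$ lies in the span of the vectors $v$, $(\nabla^2_{yy}f_m(x'',y'')+D)v$, $(\nabla^2_{yy}f_m(x'',y'')+D)^{-1}v$ and $\nabla^2_{xy}f_m(x'',y'')^{T}u$,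 with $u,v$ as before. Here $x',x''\in\mathcal M^x_m$, $y',y''\in\mathcal M_m^y$ and the diagonal matrices $D$ (with the inverses existing where used) are arbitrary. * *Communication round.* Simultaneously for all $m$, $\mathcal M^x_m$ is replaced by $\operatorname{span}\bigcup_{i:\,w_{mi}\ne0}\mathcal M_i^x$, and $\mathcal M^y_m$ by $\operatorname{span}\bigcup_{i:\,w_{mi}\ne0}\mathcal M_i^y$. * *Output* after $k$ rounds: any $x^k\in\operatorname{span}\bigcup_m\mathcal M^x_m$, $y^k\in\operatorname{span}\bigcup_m\mathcal M^y_m$. **Corollary.** There are absolute constants $c,c_0>0$ such that for all $\mu,\delta>0$, all $L>\max\{\mu,\delta\}$, all $\rho\in(0,1]$ and all $K\in\mathbb N$ there exist $d$, $M\ge 2$, a connected graph $\mathcal G$ on $\{1,\dots,M\}$ with a gossip matrix $W$ of eigengap $\rho$, and twice differentiable, $L$-smooth, $\mu$-strongly-convex-strongly-concave, $\delta$-related functions $f_1,\dots,f_M:\mathbb R^d\times\mathbb R^d\to\mathbb R$, with $\mu$-strongly-convex-strongly-concave average $f$, such that the problem $\min_x\max_yf(x,y)$ has a saddle point $z^*=(x^*,y^*)$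 with $x^*\ne0$, $y^*\ne0$, and the following holds for every $\varepsilon>0$ and every $k\le K$: if some decentralized algorithm as above has, after $k$ communication rounds, an output $z^k$ with $\|z^k-z^*\|^2\le\varepsilon$ (an $\varepsilon$-solution), then $$k\ \ge\ c\cdot\frac1{\sqrt\rho}\Big(1+\frac\delta\mu\Big)\log\frac{\|y^*\|^2}{\varepsilon}\qquad\text{whenever }\varepsilon\le c_0\|y^*\|^2 ,$$ and, in case $\delta\ge2\mu$, also $$k\ \ge\ c\cdot\frac1{\sqrt\rho}\Big(1+\frac\delta\mu\Big)\log\frac{\|z^*\|^2}{\varepsilon}\qquad\text{whenever }\varepsilon\le c_0\|z^*\|^2 .$$ -/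

import Mathlib

namespace DistSPP

/-- Euclidean space `ℝᵈ`. -/
abbrev Vec (d : ℕ) := EuclideanSpace ℝ (Fin d)

/-- The joint variable `z = (x, y) ∈ ℝ²ᵈ`, with the Euclidean norm and inner product. -/
abbrev ZVec (d : ℕ) := WithLp 2 (Vec d × Vec d)

/-- Functions `f(x, y)` on `ℝᵈ × ℝᵈ`. -/
abbrev SFun (d : ℕ) := Vec d → Vec d → ℝ

noncomputable section

variable {d M : ℕ}

/-! ### Gradients and Hessian blocks -/

/-- `∇ₓ f(x, y)`. -/
def gradX (f : SFun d) (x y : Vec d) : Vec d := gradient (fun u => f u y) x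

/-- `∇ᵧ f(x, y)`. -/
def gradY (f : SFun d) (x y : Vec d) : Vec d := gradient (fun v => f x v) y

/-- `∇²ₓₓ f(x, y)`, as an operator. -/
def hessXX (f : SFun d) (x y : Vec d) : Vec d →L[ℝ] Vec d :=
  fderiv ℝ (fun u => gradX f u y) x

/-- `∇²ₓᵧ f(x, y)`, the operator from `y`-directions to `x`-directions with matrix
`(∂²f / ∂xᵢ∂yⱼ)ᵢⱼ`; its transpose is the adjoint operator. -/
def hessXY (f : SFun d) (x y : Vec d) : Vec d →L[ℝ] Vec d :=
  fderiv ℝ (fun v => gradX f x v) y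

/-- `∇²ᵧᵧ f(x, y)`, as an operator. -/
def hessYY (f : SFun d) (x y : Vec d) : Vec d →L[ℝ] Vec d :=
  fderiv ℝ (fun v => gradY f x v) y

/-- The operator `F(z) = (∇ₓ f(x, y), -∇ᵧ f(x, y))`. -/
def saddleOp (f : SFun d) (z : ZVec d) : ZVec d :=
  WithLp.toLp 2 (gradX f z.fst z.snd, -gradY f z.fst z.snd)

/-! ### The class of problems -/

/-- `f` is twice differentiable as a function of `(x, y)`. -/
def TwiceDifferentiable (f : SFun d) : Prop :=
  Differentiable ℝ (Function.uncurry f) ∧ Differentiable ℝ (fderiv ℝ (Function.uncurry f))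

/-- `L`-smoothness: the operator `F` is `L`-Lipschitz on `ℝ²ᵈ`. -/
def Smooth (L : ℝ) (f : SFun d) : Prop :=
  ∀ z₁ z₂ : ZVec d, ‖saddleOp f z₁ - saddleOp f z₂‖ ≤ L * ‖z₁ - z₂‖

/-- `μ`-strong convexity-strong concavity on `ℝ²ᵈ`. -/
def StronglyConvexConcave (μ : ℝ) (f : SFun d) : Prop :=
  ∀ z₁ z₂ : ZVec d, μ * ‖z₁ - z₂‖ ^ 2 ≤ inner ℝ (saddleOp f z₁ - saddleOp f z₂) (z₁ - z₂)

/-- The global objective `f = (1/M) ∑ₘ fₘ`. -/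
def average (f : Fin M → SFun d) : SFun d :=
  fun x y => (1 / (M : ℝ)) * ∑ m, f m x y

/-- The local functions are `δ`-related. -/
def Related (δ : ℝ) (f : Fin M → SFun d) : Prop :=
  ∀ (m : Fin M) (x y : Vec d),
    ‖hessXX (f m) x y - hessXX (average f) x y‖ ≤ δ ∧
    ‖hessXY (f m) x y - hessXY (average f) x y‖ ≤ δ ∧
    ‖hessYY (f m) x y - hessYY (average f) x y‖ ≤ δ

/-- `(xs, ys)` solves `min_x max_y f(x, y)` over `ℝᵈ × ℝᵈ`: it is a saddle point of `f`. -/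
def IsSolution (f : SFun d) (xs ys : Vec d) : Prop :=
  IsSaddlePointOn Set.univ Set.univ f xs ys

/-! ### The network -/

/-- `W` is a gossip matrix of the graph `G`. -/
structure IsGossip (G : SimpleGraph (Fin M)) (W : Matrix (Fin M) (Fin M) ℝ) : Prop where
  diag_pos : ∀ i, 0 < W i i
  edge_pos : ∀ i j, G.Adj i j → 0 < W i j
  non_edge : ∀ i j, i ≠ j → ¬ G.Adj i j → W i j = 0
  symm : W.IsHermitian
  stochastic : ∀ i, ∑ j, W i j = 1

/-- The eigengap `1 - max {λ₂(W), |λ_min(W)|}`; `eigenvalues₀` lists the eigenvalues in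
nonincreasing order, with multiplicity. -/
def eigengap (hM : 2 ≤ M) {W : Matrix (Fin M) (Fin M) ℝ} (hW : W.IsHermitian) : ℝ :=
  1 - max (hW.eigenvalues₀ ⟨1, by rw [Fintype.card_fin]; omega⟩)
    |hW.eigenvalues₀ ⟨M - 1, by rw [Fintype.card_fin]; omega⟩|

/-! ### The optimization/communication oracle -/

/-- The operator of multiplication by the diagonal matrix with diagonal `D`. -/
def diagOp (D : Fin d → ℝ) : Vec d →L[ℝ] Vec d :=
  Matrix.toEuclideanCLM (𝕜 := ℝ) (Matrix.diagonal D)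

/-- The vectors whose span is available for an `x`-update of an agent that holds the function `f`
and the memories `Mx`, `My`. -/
inductive GenX (f : SFun d) (Mx My : Set (Vec d)) : Vec d → Prop
  | point (x' : Vec d) (hx' : x' ∈ Mx) : GenX f Mx My x'
  | grad (x' y' : Vec d) (hx' : x' ∈ Mx) (hy' : y' ∈ My) : GenX f Mx My (gradX f x' y')
  | hess_point (x' x'' y'' : Vec d) (D : Fin d → ℝ) (hx' : x' ∈ Mx) (hx'' : x'' ∈ Mx)
      (hy'' : y'' ∈ My) : GenX f Mx My ((hessXX f x'' y'' + diagOp D) x')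
  | hess_grad (x' y' x'' y'' : Vec d) (D : Fin d → ℝ) (hx' : x' ∈ Mx) (hy' : y' ∈ My)
      (hx'' : x'' ∈ Mx) (hy'' : y'' ∈ My) :
      GenX f Mx My ((hessXX f x'' y'' + diagOp D) (gradX f x' y'))
  | inv_point (x' x'' y'' : Vec d) (D : Fin d → ℝ) (T : Vec d ≃L[ℝ] Vec d) (hx' : x' ∈ Mx)
      (hx'' : x'' ∈ Mx) (hy'' : y'' ∈ My)
      (hT : (T : Vec d →L[ℝ] Vec d) = hessXX f x'' y'' + diagOp D) :
      GenX f Mx My (T.symm x')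
  | inv_grad (x' y' x'' y'' : Vec d) (D : Fin d → ℝ) (T : Vec d ≃L[ℝ] Vec d) (hx' : x' ∈ Mx)
      (hy' : y' ∈ My) (hx'' : x'' ∈ Mx) (hy'' : y'' ∈ My)
      (hT : (T : Vec d →L[ℝ] Vec d) = hessXX f x'' y'' + diagOp D) :
      GenX f Mx My (T.symm (gradX f x' y'))
  | cross_point (y' x'' y'' : Vec d) (hy' : y' ∈ My) (hx'' : x'' ∈ Mx) (hy'' : y'' ∈ My) :
      GenX f Mx My (hessXY f x'' y'' y')
  | cross_grad (x' y' x'' y'' : Vec d) (hx' : x' ∈ Mx) (hy' : y' ∈ My) (hx'' : x'' ∈ Mx)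
      (hy'' : y'' ∈ My) : GenX f Mx My (hessXY f x'' y'' (gradY f x' y'))

/-- The vectors whose span is available for a `y`-update of an agent that holds the function `f`
and the memories `Mx`, `My`. -/
inductive GenY (f : SFun d) (Mx My : Set (Vec d)) : Vec d → Prop
  | point (y' : Vec d) (hy' : y' ∈ My) : GenY f Mx My y'
  | grad (x' y' : Vec d) (hx' : x' ∈ Mx) (hy' : y' ∈ My) : GenY f Mx My (gradY f x' y')
  | hess_point (y' x'' y'' : Vec d) (D : Fin d → ℝ) (hy' : y' ∈ My) (hx'' : x'' ∈ Mx)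
      (hy'' : y'' ∈ My) : GenY f Mx My ((hessYY f x'' y'' + diagOp D) y')
  | hess_grad (x' y' x'' y'' : Vec d) (D : Fin d → ℝ) (hx' : x' ∈ Mx) (hy' : y' ∈ My)
      (hx'' : x'' ∈ Mx) (hy'' : y'' ∈ My) :
      GenY f Mx My ((hessYY f x'' y'' + diagOp D) (gradY f x' y'))
  | inv_point (y' x'' y'' : Vec d) (D : Fin d → ℝ) (T : Vec d ≃L[ℝ] Vec d) (hy' : y' ∈ My)
      (hx'' : x'' ∈ Mx) (hy'' : y'' ∈ My)
      (hT : (T : Vec d →L[ℝ] Vec d) = hessYY f x'' y'' + diagOp D) :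
      GenY f Mx My (T.symm y')
  | inv_grad (x' y' x'' y'' : Vec d) (D : Fin d → ℝ) (T : Vec d ≃L[ℝ] Vec d) (hx' : x' ∈ Mx)
      (hy' : y' ∈ My) (hx'' : x'' ∈ Mx) (hy'' : y'' ∈ My)
      (hT : (T : Vec d →L[ℝ] Vec d) = hessYY f x'' y'' + diagOp D) :
      GenY f Mx My (T.symm (gradY f x' y'))
  | cross_point (x' x'' y'' : Vec d) (hx' : x' ∈ Mx) (hx'' : x'' ∈ Mx) (hy'' : y'' ∈ My) :
      GenY f Mx My (ContinuousLinearMap.adjoint (hessXY f x'' y'') x')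
  | cross_grad (x' y' x'' y'' : Vec d) (hx' : x' ∈ Mx) (hy' : y' ∈ My) (hx'' : x'' ∈ Mx)
      (hy'' : y'' ∈ My) :
      GenY f Mx My (ContinuousLinearMap.adjoint (hessXY f x'' y'') (gradX f x' y'))

/-- The pair `(x, y)` may be computed locally by an agent that holds the function `f` and the
memories `Mx`, `My`. -/
def LocallyComputable (f : SFun d) (Mx My : Set (Vec d)) (x y : Vec d) : Prop :=
  ∃ α β θ φ : ℝ, 0 ≤ α ∧ 0 ≤ β ∧ 0 ≤ θ ∧ 0 ≤ φ ∧ 0 < α + β ∧ 0 < θ + φ ∧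
    α • x + β • gradX f x y ∈ Submodule.span ℝ {v | GenX f Mx My v} ∧
    θ • y - φ • gradY f x y ∈ Submodule.span ℝ {v | GenY f Mx My v}

/-- The memory of agent `m` after a communication round with the gossip matrix `W`: the span of the
memories of `m` and of its neighbours (the agents `i` with `W m i ≠ 0`). -/
def communicate (W : Matrix (Fin M) (Fin M) ℝ) (mem : Fin M → Set (Vec d)) :
    Fin M → Set (Vec d) :=
  fun m => (Submodule.span ℝ (⋃ i ∈ {i : Fin M | W m i ≠ 0}, mem i) : Set (Vec d))

/-- `Reachable f W k Mx My`: the agents' memories can be `Mx`, `My` at some moment of a run of an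
algorithm of the oracle class, after exactly `k` communication rounds. -/
inductive Reachable (f : Fin M → SFun d) (W : Matrix (Fin M) (Fin M) ℝ) :
    ℕ → (Fin M → Set (Vec d)) → (Fin M → Set (Vec d)) → Prop
  | init : Reachable f W 0 (fun _ => {0}) (fun _ => {0})
  | compute (k : ℕ) (Mx My : Fin M → Set (Vec d)) (m : Fin M) (x y : Vec d)
      (h : Reachable f W k Mx My) (hxy : LocallyComputable (f m) (Mx m) (My m) x y) :
      Reachable f W k (Function.update Mx m (insert x (Mx m)))
        (Function.update My m (insert y (My m)))
  | comm (k : ℕ) (Mx My : Fin M → Set (Vec d)) (h : Reachable f W k Mx My) :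
      Reachable f W (k + 1) (communicate W Mx) (communicate W My)

/-- `(x, y)` can be the global output of an algorithm of the oracle class after `k` communication
rounds. -/
def IsOutput (f : Fin M → SFun d) (W : Matrix (Fin M) (Fin M) ℝ) (k : ℕ) (x y : Vec d) : Prop :=
  ∃ Mx My : Fin M → Set (Vec d), Reachable f W k Mx My ∧
    x ∈ Submodule.span ℝ (⋃ m, Mx m) ∧ y ∈ Submodule.span ℝ (⋃ m, My m)

end

end DistSPP

namespace DistSPP

noncomputable section

variable {d M : ℕ}

/-! The local functions are quadratics `quad μ (P m) (Q m) b` whose Hessian blocks split the links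
of a chain of coordinates between two groups of agents. The vector `b` touches only position `0`.
Agents at height `0` hold the links from even positions to the next odd ones, agents at height `p`
hold the links from odd to even ones, and no other agent can advance along the chain. Every
operation of the oracle, including shifted inverses and implicit steps, keeps an agent inside each
coordinate subspace that its blocks preserve (`locallyComputable_quad_mem`). So the frontier
advances by one position only after information has crossed the network, which costs `p` rounds
(`memory_subset_of_reachable`), and outputs after `k` rounds vanish beyond position `k / p + 1`
(`isOutput_mem`). Paths realise every eigengap `ρ` with `p ≥ 1 / (6√ρ)` and two groups that each
hold at least a third of the agents (`exists_network`).

If `2μ ≤ δ`, the chain is bilinear, `x₀ – y₀ – x₁ – y₁ – …`, and its saddle point decays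
geometrically with ratio `r ^ 2`, where `log (1 / r) ≤ 6μ / δ`. The tail of `y*` beyond the frontier
bounds the error from below by a multiple of `‖z*‖²` times a power of `r` with exponent of order `k
/ p`; taking logarithms gives the bound (`exists_bilinear_problem`, `rounds_lower_bound`).

If `δ < 2μ`, only the bound in terms of `‖y*‖` is claimed. Here the chain runs through `x`, and `y*`
is a single coordinate attached to its far end, out of reach during `K` rounds. Every output then
has error at least `‖y*‖²`, so no `ε ≤ c₀‖y*‖²` is attained and the bound holds vacuously
(`exists_hidden_problem`). -/

/-- The quadratic saddle function
`(μ/2)‖x‖² + ½⟨x, P x⟩ + ⟨x, Q y⟩ - (μ/2)‖y‖² - ⟨b, x⟩`. -/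
def quad (μ : ℝ) (P Q : Vec d →L[ℝ] Vec d) (b : Vec d) : SFun d := fun x y =>
  μ / 2 * inner ℝ x x + 1 / 2 * inner ℝ x (P x) + inner ℝ x (Q y) - μ / 2 * inner ℝ y y
    - inner ℝ b x

/-! ### Gradients, Hessian blocks and saddle points of the quadratics. -/

section Calculus

variable (μ : ℝ) (P Q : Vec d →L[ℝ] Vec d) (b : Vec d)

lemma contDiff_quad : ContDiff ℝ 2 (Function.uncurry (quad μ P Q b)) := by
  have hx : ContDiff ℝ 2 (fun z : Vec d × Vec d => z.1) := contDiff_fst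
  have hy : ContDiff ℝ 2 (fun z : Vec d × Vec d => z.2) := contDiff_snd
  exact ((((contDiff_const.mul (hx.inner ℝ hx)).add
    (contDiff_const.mul (hx.inner ℝ (P.contDiff.comp hx)))).add
    (hx.inner ℝ (Q.contDiff.comp hy))).sub (contDiff_const.mul (hy.inner ℝ hy))).sub
    (contDiff_const.inner ℝ hx)

lemma twiceDifferentiable_quad : TwiceDifferentiable (quad μ P Q b) := by
  have h := contDiff_quad μ P Q b
  refine ⟨h.differentiable (by norm_num), ?_⟩
  exact (h.fderiv_right (m := 1) (by norm_num)).differentiable (by norm_num)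

variable {P}

lemma gradX_quad (hP : (P : Vec d →ₗ[ℝ] Vec d).IsSymmetric) (x y : Vec d) :
    gradX (quad μ P Q b) x y = μ • x + P x + Q y - b := by
  refine HasGradientAt.gradient ?_
  rw [hasGradientAt_iff_hasFDerivAt]
  unfold quad
  have h1 : HasFDerivAt (fun u : Vec d => u) (ContinuousLinearMap.id ℝ _) x := hasFDerivAt_id x
  have h2 : HasFDerivAt (fun u : Vec d => P u) P x := P.hasFDerivAt
  have h3 := ((((h1.inner ℝ h1).const_mul (μ / 2)).add ((h1.inner ℝ h2).const_mul (1 / 2))).add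
    (h1.inner ℝ (hasFDerivAt_const (Q y) x))).sub_const (μ / 2 * inner ℝ y y)
  have h4 := h3.sub ((hasFDerivAt_const b x).inner ℝ h1)
  refine h4.congr_fderiv ?_
  ext v
  have := hP x v
  simp only [ContinuousLinearMap.coe_coe] at this
  simp [real_inner_comm x v, fderivInnerCLM_apply, this,
    real_inner_comm (P x) v, real_inner_comm (Q y) v]
  rw [← this, real_inner_comm]
  ring

variable (P)

lemma gradY_quad (x y : Vec d) :
    gradY (quad μ P Q b) x y = ContinuousLinearMap.adjoint Q x - μ • y := by
  refine HasGradientAt.gradient ?_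
  rw [hasGradientAt_iff_hasFDerivAt]
  unfold quad
  have h1 : HasFDerivAt (fun u : Vec d => u) (ContinuousLinearMap.id ℝ _) y := hasFDerivAt_id y
  have h2 : HasFDerivAt (fun u : Vec d => Q u) Q y := Q.hasFDerivAt
  have h3 := ((((hasFDerivAt_const x y).inner ℝ h2).const_add
    (μ / 2 * inner ℝ x x + 1 / 2 * inner ℝ x (P x))).sub
    ((h1.inner ℝ h1).const_mul (μ / 2))).sub_const (inner ℝ b x)
  refine h3.congr_fderiv ?_
  ext v
  simp [real_inner_comm y v, fderivInnerCLM_apply, ContinuousLinearMap.adjoint_inner_left]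
  ring

variable {P}

lemma hessXX_quad (hP : (P : Vec d →ₗ[ℝ] Vec d).IsSymmetric) (x y : Vec d) :
    hessXX (quad μ P Q b) x y = μ • ContinuousLinearMap.id ℝ _ + P := by
  unfold hessXX
  simp_rw [gradX_quad μ Q b hP]
  exact ((((hasFDerivAt_id x).const_smul μ).add P.hasFDerivAt).add_const _ |>.sub_const _).fderiv

lemma hessXY_quad (hP : (P : Vec d →ₗ[ℝ] Vec d).IsSymmetric) (x y : Vec d) :
    hessXY (quad μ P Q b) x y = Q := by
  unfold hessXY
  simp_rw [gradX_quad μ Q b hP]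
  exact ((Q.hasFDerivAt.const_add _).sub_const _).fderiv

variable (P)

lemma hessYY_quad (x y : Vec d) :
    hessYY (quad μ P Q b) x y = -(μ • ContinuousLinearMap.id ℝ _) := by
  unfold hessYY
  simp_rw [gradY_quad μ P Q b]
  exact (((hasFDerivAt_id y).const_smul μ).const_sub _).fderiv

variable {P}

lemma saddleOp_quad_sub (hP : (P : Vec d →ₗ[ℝ] Vec d).IsSymmetric) (z₁ z₂ : ZVec d) :
    saddleOp (quad μ P Q b) z₁ - saddleOp (quad μ P Q b) z₂ =
      μ • (z₁ - z₂) + (WithLp.toLp 2 (P (z₁ - z₂).fst, 0) +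
        WithLp.toLp 2 (Q (z₁ - z₂).snd, -ContinuousLinearMap.adjoint Q (z₁ - z₂).fst)) := by
  unfold saddleOp
  simp only [gradX_quad μ Q b hP, gradY_quad μ P Q b]
  rw [← WithLp.toLp_sub, ← WithLp.toLp_add]
  apply WithLp.ofLp_injective
  ext1 <;> simp [smul_sub] <;> module

lemma smooth_quad (hP : (P : Vec d →ₗ[ℝ] Vec d).IsSymmetric) {L : ℝ} (hμ : 0 ≤ μ)
    (hL : μ + ‖P‖ + ‖Q‖ ≤ L) : Smooth L (quad μ P Q b) := by
  intro z₁ z₂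
  rw [saddleOp_quad_sub μ Q b hP]
  set z := z₁ - z₂
  have h1 : ‖WithLp.toLp 2 (P z.fst, (0 : Vec d))‖ ≤ ‖P‖ * ‖z‖ := by
    rw [WithLp.norm_toLp_fst]
    exact (P.le_opNorm _).trans
      (mul_le_mul_of_nonneg_left (WithLp.norm_fst_le _ z) (norm_nonneg _))
  have h2 : ‖WithLp.toLp 2 (Q z.snd, -ContinuousLinearMap.adjoint Q z.fst)‖ ≤ ‖Q‖ * ‖z‖ := by
    refine le_of_sq_le_sq ?_ (by positivity)
    rw [WithLp.prod_norm_sq_eq_of_L2, mul_pow, WithLp.prod_norm_sq_eq_of_L2 z]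
    have e1 := Q.le_opNorm z.snd
    have e2 := (ContinuousLinearMap.adjoint Q).le_opNorm z.fst
    rw [LinearIsometryEquiv.norm_map] at e2
    have e3 := pow_le_pow_left₀ (norm_nonneg _) e1 2
    have e4 := pow_le_pow_left₀ (norm_nonneg _) e2 2
    change ‖Q z.snd‖ ^ 2 + ‖-ContinuousLinearMap.adjoint Q z.fst‖ ^ 2 ≤ _
    rw [norm_neg]
    nlinarith
  calc _ ≤ ‖μ • z‖ + (‖P‖ * ‖z‖ + ‖Q‖ * ‖z‖) :=
        (norm_add_le _ _).trans (add_le_add le_rfl ((norm_add_le _ _).trans (add_le_add h1 h2)))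
    _ = (μ + ‖P‖ + ‖Q‖) * ‖z‖ := by rw [norm_smul, Real.norm_of_nonneg hμ]; ring
    _ ≤ L * ‖z‖ := mul_le_mul_of_nonneg_right hL (norm_nonneg _)

/-- The coupling `Q` enters the saddle operator as a skew-symmetric block and drops out of the inner
product; `P` only helps. -/
lemma stronglyConvexConcave_quad (hP : (P : Vec d →ₗ[ℝ] Vec d).IsPositive) :
    StronglyConvexConcave μ (quad μ P Q b) := by
  intro z₁ z₂
  rw [saddleOp_quad_sub μ Q b hP.1]
  set z := z₁ - z₂
  have h := hP.2 z.fst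
  simp only [ContinuousLinearMap.coe_coe, RCLike.re_to_real] at h
  rw [inner_add_left, inner_add_left, real_inner_smul_left, real_inner_self_eq_norm_sq]
  simp only [WithLp.prod_inner_apply, inner_neg_left, inner_zero_left,
    ContinuousLinearMap.adjoint_inner_left]
  have := real_inner_comm z.fst (Q z.snd)
  change _ ≤ _ + (inner ℝ (P z.fst) z.fst + 0 +
    (inner ℝ (Q z.snd) z.fst + -inner ℝ z.fst (Q z.snd)))
  linarith

/-- The hypotheses are the stationarity equations in `x` and `y`. Substituting them, the saddle
inequality becomes nonnegativity of the quadratic forms at `u - x` and `v - y`. -/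
lemma isSolution_quad (hP : (P : Vec d →ₗ[ℝ] Vec d).IsPositive) (hμ : 0 ≤ μ) {x y : Vec d}
    (hx : μ • x + P x + Q y = b) (hy : ContinuousLinearMap.adjoint Q x = μ • y) :
    IsSolution (quad μ P Q b) x y := by
  intro u _ v _
  have h := hP.2 (u - x)
  have hs := hP.1 u x
  simp only [ContinuousLinearMap.coe_coe, RCLike.re_to_real, map_sub] at h hs
  have h2 : 0 ≤ μ * inner ℝ (u - x) (u - x) := mul_nonneg hμ real_inner_self_nonneg
  have h3 : 0 ≤ μ * inner ℝ (v - y) (v - y) := mul_nonneg hμ real_inner_self_nonneg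
  have h4 : inner ℝ x (Q v) = μ * inner ℝ y v := by
    rw [← ContinuousLinearMap.adjoint_inner_left, hy, real_inner_smul_left]
  have h5 : inner ℝ x (Q y) = μ * inner ℝ y y := by
    rw [← ContinuousLinearMap.adjoint_inner_left, hy, real_inner_smul_left]
  simp only [inner_sub_left, inner_sub_right] at h h2 h3
  simp only [quad, ← hx, inner_add_left, real_inner_smul_left, h4]
  have c1 := real_inner_comm x u
  have c2 := real_inner_comm y v
  have c3 := real_inner_comm u (Q y)
  have c4 := real_inner_comm x (Q y)
  have c5 := real_inner_comm u (P x)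
  have c6 := real_inner_comm u (P u)
  have c7 := real_inner_comm x (P x)
  rw [c1] at h2
  rw [c2] at h3
  linarith

end Calculus

/-! ### Averaging the quadratics over the agents. -/

/-- The average of linear operators. -/
def opAverage (T : Fin M → Vec d →L[ℝ] Vec d) : Vec d →L[ℝ] Vec d := (1 / (M : ℝ)) • ∑ m, T m

lemma average_quad (hM : 0 < M) (μ : ℝ) (P Q : Fin M → Vec d →L[ℝ] Vec d) (b : Vec d) :
    average (fun m => quad μ (P m) (Q m) b) = quad μ (opAverage P) (opAverage Q) b := by
  have : (M : ℝ) ≠ 0 := by positivity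
  ext x y
  simp only [average, quad, opAverage, Finset.sum_add_distrib, Finset.sum_sub_distrib,
    _root_.smul_apply, _root_.sum_apply, real_inner_smul_right, inner_sum,
    Finset.sum_const, Finset.card_univ, Fintype.card_fin, nsmul_eq_mul, ← Finset.mul_sum]
  field_simp

lemma isPositive_opAverage {P : Fin M → Vec d →L[ℝ] Vec d}
    (hP : ∀ m, (P m : Vec d →ₗ[ℝ] Vec d).IsPositive) :
    (opAverage P : Vec d →ₗ[ℝ] Vec d).IsPositive := by
  constructor
  · intro x y
    have := fun m => (hP m).1 x y
    simp only [ContinuousLinearMap.coe_coe] at this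
    simp [opAverage, real_inner_smul_right, real_inner_smul_left, inner_sum, sum_inner, this]
  · intro x
    have := fun m => (hP m).2 x
    simp only [ContinuousLinearMap.coe_coe, RCLike.re_to_real] at this
    simp only [opAverage, ContinuousLinearMap.coe_coe, RCLike.re_to_real,
      _root_.smul_apply, _root_.sum_apply, real_inner_smul_left, sum_inner]
    exact mul_nonneg (by positivity) (Finset.sum_nonneg fun m _ => this m)

lemma norm_opAverage_le {T : Fin M → Vec d →L[ℝ] Vec d} {C : ℝ} (hM : 0 < M)
    (hT : ∀ m, ‖T m‖ ≤ C) : ‖opAverage T‖ ≤ C := by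
  have hM' : (0 : ℝ) < M := by positivity
  unfold opAverage
  rw [norm_smul, Real.norm_of_nonneg (by positivity)]
  have := (norm_sum_le Finset.univ T).trans (Finset.sum_le_card_nsmul _ _ C fun m _ => hT m)
  simp only [Finset.card_univ, Fintype.card_fin, nsmul_eq_mul] at this
  rw [one_div, inv_mul_le_iff₀ hM']
  exact this

lemma related_quad (hM : 0 < M) {μ δ : ℝ} {P Q : Fin M → Vec d →L[ℝ] Vec d} {b : Vec d} (hδ : 0 ≤ δ)
    (hP : ∀ m, (P m : Vec d →ₗ[ℝ] Vec d).IsPositive)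
    (hPδ : ∀ m, ‖P m - opAverage P‖ ≤ δ) (hQδ : ∀ m, ‖Q m - opAverage Q‖ ≤ δ) :
    Related δ (fun m => quad μ (P m) (Q m) b) := by
  intro m x y
  rw [average_quad hM, hessXX_quad _ _ _ (hP m).1, hessXX_quad _ _ _ (isPositive_opAverage hP).1,
    hessXY_quad _ _ _ (hP m).1, hessXY_quad _ _ _ (isPositive_opAverage hP).1, hessYY_quad,
    hessYY_quad, add_sub_add_left_eq_sub, sub_self, norm_zero]
  exact ⟨hPδ m, hQδ m, hδ⟩

/-! ### Invariant subspaces of the oracle -/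

/-- The subspaces `X`, `Y` are stable under the Hessian blocks `P`, `Q`, `Qᵀ`. -/
structure Preserves (P Q : Vec d →L[ℝ] Vec d) (X Y : Submodule ℝ (Vec d)) : Prop where
  xx : ∀ x ∈ X, P x ∈ X
  xy : ∀ y ∈ Y, Q y ∈ X
  yx : ∀ x ∈ X, ContinuousLinearMap.adjoint Q x ∈ Y

/-- An injective map of a finite-dimensional subspace into itself is onto it, so the inverse
preserves the subspace as well. This covers the shifted inverse Hessians of the oracle. -/
lemma symm_mem_of_forall_mem {X : Submodule ℝ (Vec d)} (T : Vec d ≃L[ℝ] Vec d)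
    (hT : ∀ x ∈ X, T x ∈ X) {x : Vec d} (hx : x ∈ X) : T.symm x ∈ X := by
  have hle : X.map (T.toLinearEquiv : Vec d →ₗ[ℝ] Vec d) ≤ X := by
    rintro _ ⟨u, hu, rfl⟩
    exact hT u hu
  have heq := Submodule.eq_of_le_of_finrank_eq hle (LinearEquiv.finrank_map_eq T.toLinearEquiv X)
  rw [← heq] at hx
  obtain ⟨u, hu, rfl⟩ := hx
  simpa using hu

/-- The generators of the oracle stay in `X` and `Y` by stability. The new point is only given
implicitly; monotonicity of the saddle operator forces its components orthogonal to `X` and `Y` to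
vanish. -/
lemma locallyComputable_quad_mem {μ : ℝ} (hμ : 0 < μ) {P Q : Vec d →L[ℝ] Vec d} {b : Vec d}
    (hP : (P : Vec d →ₗ[ℝ] Vec d).IsPositive) {X Y : Submodule ℝ (Vec d)}
    (hX : ∀ D, ∀ x ∈ X, diagOp D x ∈ X) (hY : ∀ D, ∀ y ∈ Y, diagOp D y ∈ Y)
    (hXY : Preserves P Q X Y) (hb : b ∈ X) {Mx My : Set (Vec d)} (hMx : Mx ⊆ X) (hMy : My ⊆ Y)
    {x y : Vec d} (h : LocallyComputable (quad μ P Q b) Mx My x y) : x ∈ X ∧ y ∈ Y := by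
  have gX : ∀ x ∈ X, ∀ y ∈ Y, gradX (quad μ P Q b) x y ∈ X := fun x hx y hy => by
    rw [gradX_quad _ _ _ hP.1]
    exact X.sub_mem (X.add_mem (X.add_mem (X.smul_mem _ hx) (hXY.xx x hx)) (hXY.xy y hy)) hb
  have gY : ∀ x ∈ X, ∀ y ∈ Y, gradY (quad μ P Q b) x y ∈ Y := fun x hx y hy => by
    rw [gradY_quad]
    exact Y.sub_mem (hXY.yx x hx) (Y.smul_mem _ hy)
  have HX : ∀ (D : Fin d → ℝ) (x'' y'' : Vec d), ∀ x ∈ X,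
      (hessXX (quad μ P Q b) x'' y'' + diagOp D) x ∈ X := by
    intro D x'' y'' x hx
    rw [hessXX_quad _ _ _ hP.1]
    exact X.add_mem (X.add_mem (X.smul_mem _ hx) (hXY.xx x hx)) (hX D x hx)
  have HY : ∀ (D : Fin d → ℝ) (x'' y'' : Vec d), ∀ y ∈ Y,
      (hessYY (quad μ P Q b) x'' y'' + diagOp D) y ∈ Y := by
    intro D x'' y'' y hy
    rw [hessYY_quad]
    exact Y.add_mem (Y.neg_mem (Y.smul_mem _ hy)) (hY D y hy)
  have hGX : Submodule.span ℝ {v | GenX (quad μ P Q b) Mx My v} ≤ X := by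
    rw [Submodule.span_le]
    rintro v hv
    induction hv with
    | point x' hx' => exact hMx hx'
    | grad x' y' hx' hy' => exact gX _ (hMx hx') _ (hMy hy')
    | hess_point x' x'' y'' D hx' => exact HX _ _ _ _ (hMx hx')
    | hess_grad x' y' x'' y'' D hx' hy' => exact HX _ _ _ _ (gX _ (hMx hx') _ (hMy hy'))
    | inv_point x' x'' y'' D T hx' _ _ hT =>
      refine symm_mem_of_forall_mem T (fun u hu => ?_) (hMx hx')
      rw [← ContinuousLinearEquiv.coe_coe, hT]
      exact HX _ _ _ _ hu
    | inv_grad x' y' x'' y'' D T hx' hy' _ _ hT =>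
      refine symm_mem_of_forall_mem T (fun u hu => ?_) (gX _ (hMx hx') _ (hMy hy'))
      rw [← ContinuousLinearEquiv.coe_coe, hT]
      exact HX _ _ _ _ hu
    | cross_point y' x'' y'' hy' =>
      rw [hessXY_quad _ _ _ hP.1]
      exact hXY.xy _ (hMy hy')
    | cross_grad x' y' x'' y'' hx' hy' =>
      rw [hessXY_quad _ _ _ hP.1]
      exact hXY.xy _ (gY _ (hMx hx') _ (hMy hy'))
  have hGY : Submodule.span ℝ {v | GenY (quad μ P Q b) Mx My v} ≤ Y := by
    rw [Submodule.span_le]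
    rintro v hv
    induction hv with
    | point y' hy' => exact hMy hy'
    | grad x' y' hx' hy' => exact gY _ (hMx hx') _ (hMy hy')
    | hess_point y' x'' y'' D hy' => exact HY _ _ _ _ (hMy hy')
    | hess_grad x' y' x'' y'' D hx' hy' => exact HY _ _ _ _ (gY _ (hMx hx') _ (hMy hy'))
    | inv_point y' x'' y'' D T hy' _ _ hT =>
      refine symm_mem_of_forall_mem T (fun u hu => ?_) (hMy hy')
      rw [← ContinuousLinearEquiv.coe_coe, hT]
      exact HY _ _ _ _ hu
    | inv_grad x' y' x'' y'' D T hx' hy' _ _ hT =>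
      refine symm_mem_of_forall_mem T (fun u hu => ?_) (gY _ (hMx hx') _ (hMy hy'))
      rw [← ContinuousLinearEquiv.coe_coe, hT]
      exact HY _ _ _ _ hu
    | cross_point x' x'' y'' hx' =>
      rw [hessXY_quad _ _ _ hP.1]
      exact hXY.yx _ (hMx hx')
    | cross_grad x' y' x'' y'' hx' hy' =>
      rw [hessXY_quad _ _ _ hP.1]
      exact hXY.yx _ (gX _ (hMx hx') _ (hMy hy'))
  obtain ⟨α, β, θ, φ, hα, hβ, hθ, hφ, hαβ, hθφ, hx, hy⟩ := h
  replace hx := hGX hx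
  replace hy := hGY hy
  rw [gradX_quad _ _ _ hP.1] at hx
  rw [gradY_quad] at hy
  -- Pairing the two memberships with the orthogonal components `x₂`, `y₂` removes everything that
  -- lies in `X` or `Y`; only the terms in `x₂`, `y₂` and their coupling `S` survive.
  obtain ⟨x₁, hx₁, x₂, hx₂, rfl⟩ := X.exists_add_mem_mem_orthogonal x
  obtain ⟨y₁, hy₁, y₂, hy₂, rfl⟩ := Y.exists_add_mem_mem_orthogonal y
  have ex := X.inner_right_of_mem_orthogonal hx hx₂
  have ey := Y.inner_right_of_mem_orthogonal hy hy₂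
  have a1 := X.inner_right_of_mem_orthogonal hx₁ hx₂
  have a2 := X.inner_right_of_mem_orthogonal (hXY.xx _ hx₁) hx₂
  have a3 := X.inner_right_of_mem_orthogonal (hXY.xy _ hy₁) hx₂
  have a4 := X.inner_right_of_mem_orthogonal hb hx₂
  have b1 := Y.inner_right_of_mem_orthogonal hy₁ hy₂
  have b2 := Y.inner_right_of_mem_orthogonal (hXY.yx _ hx₁) hy₂
  have hp := hP.2 x₂
  simp only [ContinuousLinearMap.coe_coe, RCLike.re_to_real] at hp
  simp only [map_add, smul_add, smul_sub, inner_add_left, inner_sub_left, real_inner_smul_left, a1,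
    a2, a3, a4, b1, b2, real_inner_self_eq_norm_sq, mul_zero, zero_add, sub_zero] at ex ey
  rw [ContinuousLinearMap.adjoint_inner_left, real_inner_comm] at ey
  set S := inner ℝ (Q y₂) x₂
  set R := inner ℝ (P x₂) x₂
  have key : ‖x₂‖ ^ 2 = 0 ∧ ‖y₂‖ ^ 2 = 0 := by
    have nx := sq_nonneg ‖x₂‖
    have ny := sq_nonneg ‖y₂‖
    rcases hβ.eq_or_lt with rfl | hβ
    · have hx0 : ‖x₂‖ ^ 2 = 0 := by
        have : 0 < α := by linarith
        have : α * ‖x₂‖ ^ 2 = 0 := by linarith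
        simpa [‹0 < α›.ne'] using this
      refine ⟨hx0, ?_⟩
      have hx0' : x₂ = 0 := by simpa using hx0
      have hS : S = 0 := by simp [S, hx0']
      have : (θ + φ * μ) * ‖y₂‖ ^ 2 = 0 := by rw [hS] at ey; linarith
      rcases mul_eq_zero.1 this with h | h
      · rcases hφ.eq_or_lt with rfl | hφ
        · linarith
        · nlinarith [mul_pos hφ hμ]
      · exact h
    · rcases hφ.eq_or_lt with rfl | hφ
      · have hθ' : 0 < θ := by linarith
        have hy0 : ‖y₂‖ ^ 2 = 0 := by
          have : θ * ‖y₂‖ ^ 2 = 0 := by linarith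
          simpa [hθ'.ne'] using this
        refine ⟨?_, hy0⟩
        have hy0' : y₂ = 0 := by simpa using hy0
        have hS : S = 0 := by simp [S, hy0']
        rw [hS] at ex
        have h1 : 0 ≤ α * ‖x₂‖ ^ 2 := mul_nonneg hα nx
        have h2 : 0 ≤ β * R := mul_nonneg hβ.le hp
        have h3 : 0 ≤ β * (μ * ‖x₂‖ ^ 2) := by positivity
        have h4 : β * (μ * ‖x₂‖ ^ 2) = 0 := by linarith
        simpa [hβ.ne', hμ.ne'] using h4
      -- With weights `φ` and `β` the coupling terms `S` cancel and a vanishing sum of nonnegative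
      -- terms remains. If `β` or `φ` is zero, one component vanishes directly and takes `S` with
      -- it.
      · have e : (φ * α * ‖x₂‖ ^ 2 + φ * β * R + β * θ * ‖y₂‖ ^ 2) + φ * β * μ * ‖x₂‖ ^ 2 +
            φ * β * μ * ‖y₂‖ ^ 2 = 0 := by
          linear_combination φ * ex + β * ey
        have h1 : 0 ≤ φ * α * ‖x₂‖ ^ 2 + φ * β * R + β * θ * ‖y₂‖ ^ 2 := by positivity
        have h2 : 0 ≤ φ * β * μ * ‖x₂‖ ^ 2 := by positivity
        have h3 : 0 ≤ φ * β * μ * ‖y₂‖ ^ 2 := by positivity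
        have h4 : φ * β * μ ≠ 0 := by positivity
        exact ⟨(mul_eq_zero.1 (by linarith : φ * β * μ * ‖x₂‖ ^ 2 = 0)).resolve_left h4,
          (mul_eq_zero.1 (by linarith : φ * β * μ * ‖y₂‖ ^ 2 = 0)).resolve_left h4⟩
  have hx0 : x₂ = 0 := by simpa using key.1
  have hy0 : y₂ = 0 := by simpa using key.2
  subst hx0 hy0
  simpa using ⟨hx₁, hy₁⟩

/-! ### Speed of propagation along a split chain. -/

section Oracle

/-- The vectors supported on the coordinates of position at most `j`. -/
def coordSubspace (pos : Fin d → ℕ) (j : ℕ) : Submodule ℝ (Vec d) where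
  carrier := {x | ∀ i, j < pos i → x i = 0}
  add_mem' := fun {x y} hx hy i hi => by simp [hx i hi, hy i hi]
  zero_mem' := fun i _ => rfl
  smul_mem' := fun c x hx i hi => by simp [hx i hi]

lemma coordSubspace_mono (pos : Fin d → ℕ) : Monotone (coordSubspace pos) :=
  fun _ _ hij _ hx i hi => hx i (hij.trans_lt hi)

lemma diagOp_mem_coordSubspace {pos : Fin d → ℕ} {j : ℕ} (D : Fin d → ℝ) :
    ∀ x ∈ coordSubspace pos j, diagOp D x ∈ coordSubspace pos j := by
  intro x hx i hi
  simp [diagOp, Matrix.ofLp_toEuclideanCLM, Matrix.mulVec_diagonal, hx i hi]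

/-- Distance (in a network with height function `h` of range `[0, p]`) from the agent `m` to the
side of the network on which the position `j` of the chain is first reached: the bottom for odd
`j`, the top for even `j`. -/
def sideDist (h : Fin M → ℕ) (p j : ℕ) (m : Fin M) : ℕ := if Odd j then h m else p - h m

/-- The agents at height `0` stay within the first `j` positions of the chain for odd `j`, those at
height `p` for even `j`, all others for every `j`. -/
structure SplitChain (h : Fin M → ℕ) (p : ℕ) (P Q : Fin M → Vec d →L[ℝ] Vec d)
    (posX posY : Fin d → ℕ) : Prop where
  of_odd : ∀ m j, h m ≠ p → Odd j →
    Preserves (P m) (Q m) (coordSubspace posX j) (coordSubspace posY j)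
  of_even : ∀ m j, h m ≠ 0 → Even j →
    Preserves (P m) (Q m) (coordSubspace posX j) (coordSubspace posY j)

variable {W : Matrix (Fin M) (Fin M) ℝ} {h : Fin M → ℕ} {p : ℕ}
  {P Q : Fin M → Vec d →L[ℝ] Vec d} {posX posY : Fin d → ℕ} {b : Vec d} {μ : ℝ}

/-- The threshold `j * p + sideDist h p (j + 1) m` is the earliest round at which agent `m` can hold
position `j + 1`: the frontier has crossed the network `j` times, and the new position has then
travelled to `m` from the side that produced it. -/
lemma memory_subset_of_reachable (hμ : 0 < μ) (hp : 0 < p)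
    (hW : ∀ i j, W i j ≠ 0 → h i ≤ h j + 1 ∧ h j ≤ h i + 1) (hh : ∀ m, h m ≤ p)
    (hP : ∀ m, (P m : Vec d →ₗ[ℝ] Vec d).IsPositive)
    (hc : SplitChain h p P Q posX posY) (hb : b ∈ coordSubspace posX 0) {k : ℕ}
    {Mx My : Fin M → Set (Vec d)}
    (hr : Reachable (fun m => quad μ (P m) (Q m) b) W k Mx My) :
    ∀ m j, k < j * p + sideDist h p (j + 1) m →
      Mx m ⊆ coordSubspace posX j ∧ My m ⊆ coordSubspace posY j := by
  induction hr with
  | init =>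
    intro m j _
    simp
  | compute k Mx My m x y hr hxy ih =>
    intro m' j hj
    rcases eq_or_ne m' m with rfl | hm
    swap
    · simpa [Function.update_of_ne hm] using ih m' j hj
    simp only [Function.update_self]
    have step : ∀ i, k < i * p + sideDist h p (i + 1) m' →
        Preserves (P m') (Q m') (coordSubspace posX i) (coordSubspace posY i) →
        x ∈ coordSubspace posX i ∧ y ∈ coordSubspace posY i := fun i hi hpres =>
      locallyComputable_quad_mem hμ (hP m') diagOp_mem_coordSubspace diagOp_mem_coordSubspace hpres
        (coordSubspace_mono posX (Nat.zero_le i) hb) (ih m' i hi).1 (ih m' i hi).2 hxy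
    suffices hs : x ∈ coordSubspace posX j ∧ y ∈ coordSubspace posY j from
      ⟨Set.insert_subset hs.1 (ih m' j hj).1, Set.insert_subset hs.2 (ih m' j hj).2⟩
    have lift : ∀ i, j = i + 1 → x ∈ coordSubspace posX i ∧ y ∈ coordSubspace posY i →
        x ∈ coordSubspace posX j ∧ y ∈ coordSubspace posY j := fun i hi hxy =>
      ⟨coordSubspace_mono posX (by omega) hxy.1, coordSubspace_mono posY (by omega) hxy.2⟩
    -- Only an agent on the side that produces position `j + 1` can leave level `j`. There
    -- `sideDist` is `0`, so `k < j * p`; the same agent is at distance `p` from the other side,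
    -- hence it is still confined to level `j - 1`, which its own blocks preserve.
    rcases Nat.even_or_odd j with he | ho
    · by_cases h0 : h m' = 0
      · have hodd : Odd (j + 1) := he.add_one
        simp only [sideDist, hodd, if_true, h0] at hj
        obtain ⟨i, rfl⟩ : ∃ i, j = i + 1 := by
          rcases j with _ | i
          · simp at hj
          · exact ⟨i, rfl⟩
        have hio : Odd i := by
          rcases Nat.even_or_odd i with h | h
          · exact absurd he (Nat.not_even_iff_odd.2 h.add_one)
          · exact h
        refine lift i rfl (step i ?_ (hc.of_odd m' i (by omega) hio))
        simp only [sideDist, Nat.not_odd_iff_even.2 he, if_false, h0]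
        rw [add_mul] at hj
        omega
      · exact step j hj (hc.of_even m' j h0 he)
    · by_cases h0 : h m' = p
      · have heven : Even (j + 1) := ho.add_one
        simp only [sideDist, Nat.not_odd_iff_even.2 heven, if_false, h0] at hj
        obtain ⟨i, rfl⟩ : ∃ i, j = i + 1 := by
          rcases j with _ | i
          · simp at hj
          · exact ⟨i, rfl⟩
        have hie : Even i := by
          rcases Nat.even_or_odd i with h | h
          · exact h
          · exact absurd h.add_one (Nat.not_even_iff_odd.2 ho)
        refine lift i rfl (step i ?_ (hc.of_even m' i (by omega) hie))
        simp only [sideDist, ho, if_true, h0]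
        rw [add_mul] at hj
        omega
      · exact step j hj (hc.of_odd m' j h0 ho)
  | comm k Mx My hr ih =>
    intro m j hj
    -- Heights of neighbours differ by at most one, so a round lowers the remaining distance by at
    -- most one.
    have key : ∀ i, W m i ≠ 0 →
        Mx i ⊆ coordSubspace posX j ∧ My i ⊆ coordSubspace posY j := by
      intro i hi
      refine ih i j ?_
      have h1 := hW m i hi
      have h2 := hh m
      have h3 := hh i
      unfold sideDist at hj ⊢
      split_ifs at hj ⊢ <;> omega
    constructor
    · exact Submodule.span_le.2 (Set.iUnion₂_subset fun i hi => (key i hi).1)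
    · exact Submodule.span_le.2 (Set.iUnion₂_subset fun i hi => (key i hi).2)

lemma isOutput_mem (hμ : 0 < μ) (hp : 0 < p)
    (hW : ∀ i j, W i j ≠ 0 → h i ≤ h j + 1 ∧ h j ≤ h i + 1) (hh : ∀ m, h m ≤ p)
    (hP : ∀ m, (P m : Vec d →ₗ[ℝ] Vec d).IsPositive)
    (hc : SplitChain h p P Q posX posY) (hb : b ∈ coordSubspace posX 0) {k j : ℕ}
    (hk : k < j * p) {x y : Vec d}
    (ho : IsOutput (fun m => quad μ (P m) (Q m) b) W k x y) :
    x ∈ coordSubspace posX j ∧ y ∈ coordSubspace posY j := by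
  obtain ⟨Mx, My, hr, hx, hy⟩ := ho
  have key := fun m => memory_subset_of_reachable hμ hp hW hh hP hc hb hr m j (by omega)
  exact ⟨Submodule.span_le.2 (Set.iUnion_subset fun m => (key m).1) hx,
    Submodule.span_le.2 (Set.iUnion_subset fun m => (key m).2) hy⟩

/-- The operator `T₀` for agents at height `0`, `T₁` for those at height `p`, zero otherwise. -/
def splitOp (h : Fin M → ℕ) (p : ℕ) (T₀ T₁ : Vec d →L[ℝ] Vec d) (m : Fin M) :
    Vec d →L[ℝ] Vec d :=
  if h m = 0 then T₀ else if h m = p then T₁ else 0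

lemma opAverage_splitOp {n : ℕ} (hp : 0 < p) (h0 : (Finset.univ.filter fun m => h m = 0).card = n)
    (h1 : (Finset.univ.filter fun m => h m = p).card = n) (T₀ T₁ : Vec d →L[ℝ] Vec d) :
    opAverage (splitOp h p T₀ T₁) = ((n : ℝ) / M) • (T₀ + T₁) := by
  have : ∀ m, splitOp h p T₀ T₁ m = (if h m = 0 then T₀ else 0) + (if h m = p then T₁ else 0) := by
    intro m
    unfold splitOp
    split_ifs <;> first | omega | simp
  simp only [opAverage, this, Finset.sum_add_distrib, ← Finset.sum_filter, Finset.sum_const, h0, h1]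
  rw [← Nat.cast_smul_eq_nsmul ℝ, ← Nat.cast_smul_eq_nsmul ℝ, ← smul_add, smul_smul]
  congr 1
  ring

lemma splitOp_ind {h : Fin M → ℕ} {p : ℕ} {T₀ T₁ : Vec d →L[ℝ] Vec d}
    {R : (Vec d →L[ℝ] Vec d) → Prop} (h0 : R T₀) (h1 : R T₁) (hz : R 0) (m : Fin M) :
    R (splitOp h p T₀ T₁ m) := by
  unfold splitOp
  split_ifs <;> assumption

end Oracle

section Network

open Matrix

/-! ### Variational description of the eigengap. -/

section Spectrum

variable {M : ℕ} {W : Matrix (Fin M) (Fin M) ℝ} (hW : W.IsHermitian)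

/-- An orthonormal eigenbasis sorted by decreasing eigenvalues. -/
lemma exists_sorted_eigenbasis :
    ∃ v : OrthonormalBasis (Fin (Fintype.card (Fin M))) ℝ (Vec M),
      ∀ i, W *ᵥ (v i).ofLp = hW.eigenvalues₀ i • (v i).ofLp := by
  refine ⟨(isSymmetric_toEuclideanLin_iff.mpr hW).eigenvectorBasis finrank_euclideanSpace,
    fun i => ?_⟩
  have := (isSymmetric_toEuclideanLin_iff.mpr hW).apply_eigenvectorBasis finrank_euclideanSpace i
  exact congrArg WithLp.ofLp this

/-- Half of Courant–Fischer: the span of the eigenvectors `i` and `j` contains a nonzero vector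
orthogonal to `w`, and its Rayleigh quotient is at least the smaller eigenvalue `j`. -/
lemma eigenvalues₀_le_of_orthogonal (w : Fin M → ℝ) {C : ℝ}
    (hC : ∀ u : Fin M → ℝ, w ⬝ᵥ u = 0 → u ⬝ᵥ W *ᵥ u ≤ C * (u ⬝ᵥ u))
    {i j : Fin (Fintype.card (Fin M))} (hij : i < j) : hW.eigenvalues₀ j ≤ C := by
  obtain ⟨v, hv⟩ := exists_sorted_eigenbasis hW
  have hle := hW.eigenvalues₀_antitone hij.le
  have orth : ∀ a b, (v a).ofLp ⬝ᵥ (v b).ofLp = if a = b then 1 else 0 := fun a b => by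
    have := orthonormal_iff_ite.1 v.orthonormal b a
    rw [EuclideanSpace.inner_eq_star_dotProduct] at this
    simpa [eq_comm] using this
  have key : ∀ α β : ℝ, α * (w ⬝ᵥ (v i).ofLp) + β * (w ⬝ᵥ (v j).ofLp) = 0 →
      hW.eigenvalues₀ i * α ^ 2 + hW.eigenvalues₀ j * β ^ 2 ≤ C * (α ^ 2 + β ^ 2) := by
    intro α β h
    have := hC (α • (v i).ofLp + β • (v j).ofLp) (by
      rw [dotProduct_add, dotProduct_smul, dotProduct_smul]; simpa using h)
    simp only [mulVec_add, mulVec_smul, hv, dotProduct_add, add_dotProduct, smul_dotProduct,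
      dotProduct_smul, orth, smul_eq_mul, if_true, hij.ne, hij.ne', if_false] at this
    nlinarith
  by_cases h0 : w ⬝ᵥ (v j).ofLp = 0
  · have := key 0 1 (by simp [h0])
    simpa using this
  -- These coefficients make the combination of the two eigenvectors orthogonal to `w`.
  · have := key (w ⬝ᵥ (v j).ofLp) (-(w ⬝ᵥ (v i).ofLp)) (by ring)
    have hpos : 0 < (w ⬝ᵥ (v j).ofLp) ^ 2 := by positivity
    nlinarith [sq_nonneg (w ⬝ᵥ (v i).ofLp)]

lemma inner_sorted_eigenbasis_mulVec {v : OrthonormalBasis (Fin (Fintype.card (Fin M))) ℝ (Vec M)}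
    (hv : ∀ i, W *ᵥ (v i).ofLp = hW.eigenvalues₀ i • (v i).ofLp) (u : Fin M → ℝ)
    (i : Fin (Fintype.card (Fin M))) :
    inner ℝ (v i) (WithLp.toLp 2 (W *ᵥ u) : Vec M) =
      hW.eigenvalues₀ i * inner ℝ (v i) (WithLp.toLp 2 u : Vec M) := by
  have hT : Wᵀ = W := by simpa [IsHermitian] using hW
  have e1 : (W *ᵥ u) ⬝ᵥ (v i).ofLp = u ⬝ᵥ W *ᵥ (v i).ofLp := by
    rw [dotProduct_mulVec, ← mulVec_transpose, hT]
  rw [hv, dotProduct_smul] at e1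
  simpa [EuclideanSpace.inner_eq_star_dotProduct] using e1

lemma exists_eigenvalues₀_eq {u : Fin M → ℝ} (hu : u ≠ 0) {C : ℝ} (h : W *ᵥ u = C • u) :
    ∃ i, hW.eigenvalues₀ i = C := by
  obtain ⟨v, hv⟩ := exists_sorted_eigenbasis hW
  obtain ⟨i, hi⟩ : ∃ i, inner ℝ (v i) (WithLp.toLp 2 u : Vec M) ≠ 0 := by
    by_contra! hcon
    refine hu ?_
    have : (WithLp.toLp 2 u : Vec M) = 0 := by
      rw [← v.sum_repr' (WithLp.toLp 2 u : Vec M)]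
      simp [hcon]
    simpa using congrArg WithLp.ofLp this
  refine ⟨i, mul_right_cancel₀ hi ?_⟩
  rw [← inner_sorted_eigenbasis_mulVec hW hv, h, WithLp.toLp_smul, real_inner_smul_right]

/-- As all eigenvalues from index `1` on are below `1`, the fixed vector `w` is a multiple of the
top eigenvector. Hence `u` has no component there, and the other eigenvalues are at most the second.
-/
lemma dotProduct_mulVec_le_of_orthogonal {w : Fin M → ℝ} (hw : W *ᵥ w = w) (hw0 : w ≠ 0)
    {i₁ : Fin (Fintype.card (Fin M))} (hi : i₁.val = 1) (hlt : hW.eigenvalues₀ i₁ < 1)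
    {u : Fin M → ℝ} (hu : w ⬝ᵥ u = 0) :
    u ⬝ᵥ W *ᵥ u ≤ hW.eigenvalues₀ i₁ * (u ⬝ᵥ u) := by
  obtain ⟨v, hv⟩ := exists_sorted_eigenbasis hW
  have hanti := hW.eigenvalues₀_antitone
  have expand : ∀ a b : Fin M → ℝ, a ⬝ᵥ b =
      ∑ i, inner ℝ (v i) (WithLp.toLp 2 a : Vec M) * inner ℝ (v i) (WithLp.toLp 2 b : Vec M) := by
    intro a b
    have := v.sum_inner_mul_inner (WithLp.toLp 2 a : Vec M) (WithLp.toLp 2 b : Vec M)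
    rw [EuclideanSpace.inner_eq_star_dotProduct] at this
    simp only [star_trivial] at this
    rw [dotProduct_comm, ← this]
    exact Finset.sum_congr rfl fun i _ => by rw [real_inner_comm]
  set i₀ : Fin (Fintype.card (Fin M)) := ⟨0, by have := i₁.2; omega⟩
  have hle : ∀ i, i ≠ i₀ → hW.eigenvalues₀ i ≤ hW.eigenvalues₀ i₁ := fun i hi0 => by
    refine hanti (Fin.le_def.2 ?_)
    have : i.val ≠ 0 := fun h => hi0 (Fin.ext h)
    omega
  have hwi : ∀ i, i ≠ i₀ → inner ℝ (v i) (WithLp.toLp 2 w : Vec M) = 0 := fun i hi0 => by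
    have h := inner_sorted_eigenbasis_mulVec hW hv w i
    rw [hw] at h
    have h2 := hle i hi0
    by_contra hne
    have : hW.eigenvalues₀ i = 1 := by
      refine mul_right_cancel₀ hne ?_
      rw [← h, one_mul]
    linarith
  have hw₀ : inner ℝ (v i₀) (WithLp.toLp 2 w : Vec M) ≠ 0 := fun h => by
    have := expand w w
    rw [Finset.sum_eq_zero fun i _ => ?_, dotProduct_self_eq_zero] at this
    · exact hw0 this
    · rcases eq_or_ne i i₀ with rfl | hi0
      · simp [h]
      · simp [hwi i hi0]
  have hu₀ : inner ℝ (v i₀) (WithLp.toLp 2 u : Vec M) = 0 := by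
    rw [expand, Finset.sum_eq_single i₀ (fun i _ hi0 => by simp [hwi i hi0]) (by simp)] at hu
    exact (mul_eq_zero.1 hu).resolve_left hw₀
  rw [expand, expand, Finset.mul_sum]
  refine Finset.sum_le_sum fun i _ => ?_
  rw [inner_sorted_eigenbasis_mulVec hW hv]
  rcases eq_or_ne i i₀ with rfl | hi0
  · simp [hu₀]
  · nlinarith [hle i hi0, mul_self_nonneg (inner ℝ (v i) (WithLp.toLp 2 u : Vec M))]

/-- The Rayleigh bound on the complement of `1` gives `λ₂ ≤ 1 - ρ`. Conversely `1 - ρ` is an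
eigenvalue different from the eigenvalue `1`, so its index is not the top one. Positivity makes the
term `|λ_min|` irrelevant. -/
lemma eigengap_eq (hM : 2 ≤ M) {ρ : ℝ} (hρ : 0 < ρ) (h1 : W *ᵥ 1 = 1)
    (hle : ∀ u : Fin M → ℝ, 1 ⬝ᵥ u = 0 → u ⬝ᵥ W *ᵥ u ≤ (1 - ρ) * (u ⬝ᵥ u))
    (hpos : ∀ u : Fin M → ℝ, 0 ≤ u ⬝ᵥ W *ᵥ u)
    {u : Fin M → ℝ} (hu : u ≠ 0) (hWu : W *ᵥ u = (1 - ρ) • u) :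
    eigengap hM hW = ρ := by
  have hc : Fintype.card (Fin M) = M := Fintype.card_fin M
  have hanti := hW.eigenvalues₀_antitone
  set i₁ : Fin (Fintype.card (Fin M)) := ⟨1, by omega⟩
  set iL : Fin (Fintype.card (Fin M)) := ⟨M - 1, by omega⟩
  have hlt : (⟨0, by omega⟩ : Fin (Fintype.card (Fin M))) < i₁ := Fin.lt_def.2 one_pos
  have up := eigenvalues₀_le_of_orthogonal hW 1 hle hlt
  have one_ne : (1 : Fin M → ℝ) ≠ 0 := fun h => by
    simpa using congrFun h ⟨0, by omega⟩
  obtain ⟨a, ha⟩ := exists_eigenvalues₀_eq hW one_ne (C := 1) (by simpa using h1)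
  obtain ⟨c, hcv⟩ := exists_eigenvalues₀_eq hW hu hWu
  have low : 1 - ρ ≤ hW.eigenvalues₀ i₁ := by
    rw [← hcv]
    refine hanti ?_
    by_contra hlt
    have hc0 : c ≤ a := by
      rw [Fin.le_def]
      rw [not_le, Fin.lt_def] at hlt
      simp only [i₁] at hlt
      omega
    have := hanti hc0
    linarith
  have hL : 0 ≤ hW.eigenvalues₀ iL := by
    obtain ⟨v, hv⟩ := exists_sorted_eigenbasis hW
    have h := hpos (v iL).ofLp
    have hn : (v iL).ofLp ⬝ᵥ (v iL).ofLp = 1 := by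
      have := orthonormal_iff_ite.1 v.orthonormal iL iL
      rw [EuclideanSpace.inner_eq_star_dotProduct] at this
      simpa using this
    rw [hv, dotProduct_smul, hn] at h
    simpa using h
  have hL1 : hW.eigenvalues₀ iL ≤ hW.eigenvalues₀ i₁ := hanti (by
    rw [Fin.le_def]; simp only [i₁, iL]; omega)
  unfold eigengap
  change 1 - max (hW.eigenvalues₀ i₁) |hW.eigenvalues₀ iL| = ρ
  rw [abs_of_nonneg hL, max_eq_left hL1]
  linarith

end Spectrum

/-! ### Gossip matrices of paths with prescribed eigengap. -/

section Path

open SimpleGraph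

variable {N : ℕ}

instance (n : ℕ) : DecidableRel (pathGraph n).Adj := fun _ _ =>
  decidable_of_iff _ pathGraph_adj.symm

/-- The gossip matrix `I - s·Lap` of the path on `N + 1` vertices. -/
def pathGossip (N : ℕ) (s : ℝ) : Matrix (Fin (N + 1)) (Fin (N + 1)) ℝ :=
  1 - s • (pathGraph (N + 1)).lapMatrix ℝ

lemma dotProduct_lapMatrix_pathGraph (u : Fin (N + 1) → ℝ) :
    u ⬝ᵥ (pathGraph (N + 1)).lapMatrix ℝ *ᵥ u =
      ∑ e : Fin N, (u e.castSucc - u e.succ) ^ 2 := by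
  have h := lapMatrix_toLinearMap₂' ℝ (pathGraph (N + 1)) u
  rw [Matrix.toLinearMap₂'_apply'] at h
  rw [h]
  have split : ∀ i j : Fin (N + 1), (if (pathGraph (N + 1)).Adj i j then (u i - u j) ^ 2 else 0) =
      (if i.val + 1 = j.val then (u i - u j) ^ 2 else 0) +
        (if j.val + 1 = i.val then (u j - u i) ^ 2 else 0) := by
    intro i j
    simp only [pathGraph_adj]
    split_ifs <;> first | omega | ring
  have main : ∑ i : Fin (N + 1), ∑ j : Fin (N + 1),
      (if i.val + 1 = j.val then (u i - u j) ^ 2 else 0) =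
        ∑ e : Fin N, (u e.castSucc - u e.succ) ^ 2 := by
    rw [Fin.sum_univ_castSucc]
    have hlast : ∑ j : Fin (N + 1),
        (if (Fin.last N).val + 1 = j.val then (u (Fin.last N) - u j) ^ 2 else 0) = 0 :=
      Finset.sum_eq_zero fun j _ => if_neg (by have := j.2; simp; omega)
    rw [hlast, add_zero]
    refine Finset.sum_congr rfl fun e _ => ?_
    rw [Finset.sum_eq_single e.succ]
    · simp
    · intro j _ hj
      refine if_neg fun h => hj (Fin.ext ?_)
      simpa using h.symm
    · simp
  simp only [split, Finset.sum_add_distrib]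
  rw [Finset.sum_comm (f := fun i j : Fin (N + 1) => if j.val + 1 = i.val then (u j - u i) ^ 2 else 0),
    main]
  ring

lemma dotProduct_lapMatrix_pathGraph_le (u : Fin (N + 1) → ℝ) :
    u ⬝ᵥ (pathGraph (N + 1)).lapMatrix ℝ *ᵥ u ≤ 4 * (u ⬝ᵥ u) := by
  rw [dotProduct_lapMatrix_pathGraph]
  have h1 : ∑ e : Fin N, (u e.castSucc - u e.succ) ^ 2 ≤
      2 * ∑ e : Fin N, u e.castSucc ^ 2 + 2 * ∑ e : Fin N, u e.succ ^ 2 := by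
    rw [Finset.mul_sum, Finset.mul_sum, ← Finset.sum_add_distrib]
    exact Finset.sum_le_sum fun e _ => by nlinarith [sq_nonneg (u e.castSucc + u e.succ)]
  have h2 : u ⬝ᵥ u = ∑ e : Fin N, u e.castSucc ^ 2 + u (Fin.last N) ^ 2 := by
    simp [dotProduct, Fin.sum_univ_castSucc, sq]
  have h3 : u ⬝ᵥ u = u 0 ^ 2 + ∑ e : Fin N, u e.succ ^ 2 := by
    simp [dotProduct, Fin.sum_univ_succ, sq]
  nlinarith [sq_nonneg (u 0), sq_nonneg (u (Fin.last N))]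

/-- Telescoping along the path from `i` to `j`, then Cauchy–Schwarz over at most `N` edges. -/
lemma sq_sub_le_dotProduct_lapMatrix_pathGraph (u : Fin (N + 1) → ℝ) (i j : Fin (N + 1)) :
    (u i - u j) ^ 2 ≤ N * (u ⬝ᵥ (pathGraph (N + 1)).lapMatrix ℝ *ᵥ u) := by
  wlog hij : i ≤ j generalizing i j
  · rw [← neg_sub, neg_sq]
    exact this j i (not_le.1 hij).le
  rw [dotProduct_lapMatrix_pathGraph]
  -- Extension of `u` by zero to `ℕ`, so that the differences telescope over an interval; only
  -- values inside the path are used.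
  set U : ℕ → ℝ := fun k => if h : k < N + 1 then u ⟨k, h⟩ else 0 with hU
  have hUv : ∀ k : Fin (N + 1), U k = u k := fun k => dif_pos k.2
  have e1 : ∑ e : Fin N, (u e.castSucc - u e.succ) ^ 2 =
      ∑ k ∈ Finset.range N, (U (k + 1) - U k) ^ 2 := by
    rw [Finset.sum_range]
    refine Finset.sum_congr rfl fun e _ => ?_
    rw [← hUv, ← hUv]
    simp
    ring
  have e2 : u j - u i = ∑ k ∈ Finset.Ico (i : ℕ) j, (U (k + 1) - U k) := by
    rw [Finset.sum_Ico_sub _ (by exact_mod_cast hij), hUv, hUv]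
  have hsub : Finset.Ico (i : ℕ) j ⊆ Finset.range N := fun k hk => by
    have := j.2
    simp only [Finset.mem_Ico, Finset.mem_range] at *
    omega
  rw [← neg_sub, neg_sq, e2, e1]
  refine (sq_sum_le_card_mul_sum_sq).trans ?_
  have hcard : ((Finset.Ico (i : ℕ) j).card : ℝ) ≤ N := by
    have := Finset.card_le_card hsub
    rw [Finset.card_range] at this
    exact_mod_cast this
  exact mul_le_mul hcard
    (Finset.sum_le_sum_of_subset_of_nonneg hsub fun _ _ _ => sq_nonneg _)
    (Finset.sum_nonneg fun _ _ => sq_nonneg _) (Nat.cast_nonneg _)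

/-- A Poincaré inequality on the path. -/
lemma dotProduct_self_le_lapMatrix_pathGraph (u : Fin (N + 1) → ℝ) (hu : 1 ⬝ᵥ u = 0) :
    2 * (u ⬝ᵥ u) ≤ (N + 1 : ℝ) ^ 2 * (u ⬝ᵥ (pathGraph (N + 1)).lapMatrix ℝ *ᵥ u) := by
  set E := u ⬝ᵥ (pathGraph (N + 1)).lapMatrix ℝ *ᵥ u with hE
  have hE0 : 0 ≤ E := by
    rw [hE, dotProduct_lapMatrix_pathGraph]
    exact Finset.sum_nonneg fun _ _ => sq_nonneg _
  have hsum : ∑ i, u i = 0 := by simpa [dotProduct] using hu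
  -- For mean-zero `u` the cross terms in the sum over all pairs vanish; each pair is then bounded
  -- by the path energy.
  have h1 : ∑ i, ∑ j, (u i - u j) ^ 2 = 2 * (N + 1) * (u ⬝ᵥ u) := by
    have : ∀ i j, (u i - u j) ^ 2 = u i * u i + -2 * u i * u j + u j * u j := fun i j => by ring
    simp only [this, Finset.sum_add_distrib, ← Finset.mul_sum, hsum, mul_zero, Finset.sum_const,
      Finset.card_univ, Fintype.card_fin, dotProduct, nsmul_eq_mul]
    simp only [mul_left_comm (u _) ((N + 1 : ℕ) : ℝ), ← Finset.mul_sum]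
    push_cast
    ring
  have h2 : ∑ i, ∑ j, (u i - u j) ^ 2 ≤ (N + 1) * ((N + 1) * (N * E)) := by
    have : ∑ i : Fin (N + 1), ∑ j : Fin (N + 1), (u i - u j) ^ 2 ≤
        ∑ _i : Fin (N + 1), ∑ _j : Fin (N + 1), N * E :=
      Finset.sum_le_sum fun i _ => Finset.sum_le_sum fun j _ =>
        sq_sub_le_dotProduct_lapMatrix_pathGraph u i j
    simpa using this
  rw [h1] at h2
  have hN : (0 : ℝ) < N + 1 := by positivity
  have h3 : 2 * (u ⬝ᵥ u) ≤ (N + 1) * (N * E) := by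
    refine le_of_mul_le_mul_left ?_ hN
    linarith
  nlinarith

lemma pathGossip_isHermitian (s : ℝ) : (pathGossip N s).IsHermitian := by
  refine isHermitian_one.sub ?_
  have := isHermitian_lapMatrix (R := ℝ) (pathGraph (N + 1))
  exact this.smul (IsSelfAdjoint.all s)

lemma pathGossip_mulVec (s : ℝ) (u : Fin (N + 1) → ℝ) :
    pathGossip N s *ᵥ u = u - s • ((pathGraph (N + 1)).lapMatrix ℝ *ᵥ u) := by
  rw [pathGossip, sub_mulVec, one_mulVec, smul_mulVec]

lemma pathGossip_mulVec_one (s : ℝ) : pathGossip N s *ᵥ 1 = 1 := by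
  have h := lapMatrix_mulVec_const_eq_zero (R := ℝ) (pathGraph (N + 1))
  have h2 : (1 : Fin (N + 1) → ℝ) = fun _ => 1 := rfl
  rw [pathGossip_mulVec, h2, h]
  simp

lemma dotProduct_pathGossip (s : ℝ) (u : Fin (N + 1) → ℝ) :
    u ⬝ᵥ pathGossip N s *ᵥ u =
      u ⬝ᵥ u - s * (u ⬝ᵥ (pathGraph (N + 1)).lapMatrix ℝ *ᵥ u) := by
  rw [pathGossip_mulVec, dotProduct_sub, dotProduct_smul, smul_eq_mul]

lemma pathGossip_apply_of_ne (s : ℝ) {i j : Fin (N + 1)} (hij : i ≠ j) :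
    pathGossip N s i j = if (pathGraph (N + 1)).Adj i j then s else 0 := by
  simp [pathGossip, lapMatrix, degMatrix, hij, adjMatrix_apply]

lemma isGossip_pathGossip {s : ℝ} (hs : 0 < s) (hd : ∀ i, 0 < pathGossip N s i i) :
    IsGossip (pathGraph (N + 1)) (pathGossip N s) where
  diag_pos := hd
  edge_pos i j h := by rw [pathGossip_apply_of_ne s h.ne, if_pos h]; exact hs
  non_edge i j hij h := by rw [pathGossip_apply_of_ne s hij, if_neg h]
  symm := pathGossip_isHermitian s
  stochastic i := by
    have := congrFun (pathGossip_mulVec_one (N := N) s) i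
    simpa [mulVec, dotProduct] using this

lemma pathGossip_apply_self (s : ℝ) (i : Fin (N + 1)) :
    pathGossip N s i i = Pi.single i 1 ⬝ᵥ pathGossip N s *ᵥ Pi.single i 1 := by
  simp

/-- The Laplacian of a single edge has eigenvalues `0` and `2`, so the step `ρ / 2` produces the
spectrum `1`, `1 - ρ`. -/
lemma exists_pathGossip_two {ρ : ℝ} (hρ : 0 < ρ) (hρ1 : ρ ≤ 1) :
    ∃ hW : IsGossip (pathGraph 2) (pathGossip 1 (ρ / 2)), eigengap le_rfl hW.symm = ρ := by
  have form : ∀ u : Fin 2 → ℝ, u ⬝ᵥ pathGossip 1 (ρ / 2) *ᵥ u =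
      u 0 ^ 2 + u 1 ^ 2 - ρ / 2 * (u 0 - u 1) ^ 2 := fun u => by
    rw [dotProduct_pathGossip, dotProduct_lapMatrix_pathGraph]
    simp [dotProduct, Fin.sum_univ_two]
    ring
  have hpos : ∀ u : Fin 2 → ℝ, 0 ≤ u ⬝ᵥ pathGossip 1 (ρ / 2) *ᵥ u := fun u => by
    rw [form]
    nlinarith [sq_nonneg (u 0 + u 1), sq_nonneg (u 0 - u 1)]
  refine ⟨isGossip_pathGossip (by positivity) fun i => ?_, ?_⟩
  · rw [pathGossip_apply_self, form]
    fin_cases i <;> simp <;> linarith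
  · refine eigengap_eq _ _ hρ (pathGossip_mulVec_one _) (fun u hu => ?_) hpos
      (u := ![1, -1]) (fun h => by simpa using congrFun h 0) ?_
    · rw [form]
      have : u 1 = - u 0 := by
        simp [dotProduct, Fin.sum_univ_two] at hu
        linarith
      simp [dotProduct, Fin.sum_univ_two, this]
      nlinarith
    · have h01 : (pathGraph 2).Adj 0 1 := by simp [pathGraph_adj]
      have a01 := pathGossip_apply_of_ne (N := 1) (ρ / 2) (i := 0) (j := 1) (by simp)
      have a10 := pathGossip_apply_of_ne (N := 1) (ρ / 2) (i := 1) (j := 0) (by simp)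
      rw [if_pos h01] at a01
      rw [if_pos h01.symm] at a10
      have r := pathGossip_mulVec_one (N := 1) (ρ / 2)
      have r0 := congrFun r 0
      have r1 := congrFun r 1
      rw [mulVec, dotProduct, Fin.sum_univ_two, Pi.one_apply, Pi.one_apply] at r0 r1
      rw [a01] at r0
      rw [a10] at r1
      ext i
      fin_cases i
      · simp [mulVec, dotProduct, Fin.sum_univ_two, a01]
        linarith
      · simp [mulVec, dotProduct, Fin.sum_univ_two, a10]
        linarith

/-- The Poincaré inequality bounds the gap at step `1 / 8` from below. The gap is linear in the
step, so shrinking the step attains `ρ` exactly, and small steps keep the matrix positive definite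
because the Laplacian is at most `4`. -/
lemma exists_pathGossip {ρ : ℝ} (hρ : 0 < ρ) (hN : 1 ≤ N) (hρN : 4 * (N + 1 : ℝ) ^ 2 * ρ ≤ 1) :
    ∃ (s : ℝ) (hW : IsGossip (pathGraph (N + 1)) (pathGossip N s)),
      eigengap (by omega : 2 ≤ N + 1) hW.symm = ρ := by
  have hN0 : (0 : ℝ) < (N + 1 : ℝ) ^ 2 := by positivity
  set V := pathGossip N (1 / 8) with hVdef
  have hV : V.IsHermitian := pathGossip_isHermitian _
  have hc : Fintype.card (Fin (N + 1)) = N + 1 := Fintype.card_fin _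
  set i₁ : Fin (Fintype.card (Fin (N + 1))) := ⟨1, by omega⟩
  have hlt : (⟨0, by omega⟩ : Fin (Fintype.card (Fin (N + 1)))) < i₁ := Fin.lt_def.2 one_pos
  have gap_of : ∀ C, (∀ u : Fin (N + 1) → ℝ, 1 ⬝ᵥ u = 0 → u ⬝ᵥ V *ᵥ u ≤ C * (u ⬝ᵥ u)) →
      hV.eigenvalues₀ i₁ ≤ C := fun C h => eigenvalues₀_le_of_orthogonal hV 1 h hlt
  set g := 1 - hV.eigenvalues₀ i₁ with hg
  have hg1 : 1 / (4 * (N + 1 : ℝ) ^ 2) ≤ g := by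
    have := gap_of (1 - 1 / (4 * (N + 1 : ℝ) ^ 2)) fun u hu => by
      have h := dotProduct_self_le_lapMatrix_pathGraph u hu
      rw [hVdef, dotProduct_pathGossip]
      have : 1 / (4 * (N + 1 : ℝ) ^ 2) * (u ⬝ᵥ u) ≤
          1 / 8 * (u ⬝ᵥ (pathGraph (N + 1)).lapMatrix ℝ *ᵥ u) := by
        rw [div_mul_eq_mul_div, div_le_iff₀ (by positivity)]
        linarith
      linarith
    linarith
  have hρg : ρ ≤ g := by
    refine le_trans ?_ hg1
    rw [le_div_iff₀ (by positivity)]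
    linarith
  have hg0 : 0 < g := hρ.trans_le hρg
  obtain ⟨v, hv⟩ := exists_sorted_eigenbasis hV
  have hVu := hv i₁
  replace hVu := (pathGossip_mulVec (1 / 8) _).symm.trans hVu
  have hLu : (pathGraph (N + 1)).lapMatrix ℝ *ᵥ (v i₁).ofLp = (8 * g) • (v i₁).ofLp := by
    have : (1 / 8 : ℝ) • ((pathGraph (N + 1)).lapMatrix ℝ *ᵥ (v i₁).ofLp) = g • (v i₁).ofLp := by
      rw [hg, sub_smul, one_smul, ← hVu]
      abel
    rw [mul_smul, ← this, smul_smul]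
    norm_num
  have hform : ∀ u : Fin (N + 1) → ℝ, 1 ⬝ᵥ u = 0 →
      8 * g * (u ⬝ᵥ u) ≤ u ⬝ᵥ (pathGraph (N + 1)).lapMatrix ℝ *ᵥ u := fun u hu => by
    have h := dotProduct_mulVec_le_of_orthogonal hV (pathGossip_mulVec_one _)
      (fun h => by simpa using congrFun h 0) (i₁ := i₁) rfl (by linarith) hu
    replace h := (dotProduct_pathGossip (1 / 8) u).symm.le.trans h
    have : hV.eigenvalues₀ i₁ = 1 - g := by ring
    rw [this] at h
    linarith
  -- Since the gap at step `1 / 8` is `g`, the least Laplacian eigenvalue on the complement of `1`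
  -- is `8 * g`.
  set s := ρ / (8 * g) with hs
  have hs0 : 0 < s := by positivity
  have hs1 : s ≤ 1 / 8 := by
    rw [hs, div_le_iff₀ (by positivity)]
    linarith
  have hsg : s * (8 * g) = ρ := div_mul_cancel₀ _ (by positivity)
  have hlow : ∀ u : Fin (N + 1) → ℝ, 1 / 2 * (u ⬝ᵥ u) ≤ u ⬝ᵥ pathGossip N s *ᵥ u := fun u => by
    rw [dotProduct_pathGossip]
    have h1 := dotProduct_lapMatrix_pathGraph_le u
    have h2 : 0 ≤ u ⬝ᵥ u := by simpa using dotProduct_star_self_nonneg u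
    nlinarith
  refine ⟨s, isGossip_pathGossip hs0 fun i => ?_, ?_⟩
  · rw [pathGossip_apply_self]
    refine lt_of_lt_of_le ?_ (hlow _)
    simp
  · refine eigengap_eq _ _ hρ (pathGossip_mulVec_one _) (fun u hu => ?_)
      (fun u => le_trans ?_ (hlow u)) (u := (v i₁).ofLp) (fun h => ?_) ?_
    · rw [dotProduct_pathGossip]
      rw [← hsg]
      nlinarith [mul_le_mul_of_nonneg_left (hform u hu) hs0.le]
    · have h2 : 0 ≤ u ⬝ᵥ u := by simpa using dotProduct_star_self_nonneg u
      positivity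
    · exact v.toBasis.ne_zero i₁ (by simpa using congrArg (WithLp.toLp 2) h)
    · rw [pathGossip_mulVec, hLu, smul_smul, hsg, sub_smul, one_smul]

/-- Networks with eigengap `ρ` in which two groups, each of at least a third of the agents, lie at
distance at least `1 / (6√ρ)`; the distance is witnessed by a height function `h`. -/
lemma exists_network {ρ : ℝ} (hρ : 0 < ρ) (hρ1 : ρ ≤ 1) :
    ∃ (M : ℕ) (hM : 2 ≤ M) (G : SimpleGraph (Fin M)) (W : Matrix (Fin M) (Fin M) ℝ)
      (hW : IsGossip G W) (h : Fin M → ℕ) (p n : ℕ), G.Connected ∧ eigengap hM hW.symm = ρ ∧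
      0 < p ∧ 1 / (6 * √ρ) ≤ p ∧ (∀ m, h m ≤ p) ∧
      (∀ i j, W i j ≠ 0 → h i ≤ h j + 1 ∧ h j ≤ h i + 1) ∧
      (Finset.univ.filter fun m => h m = 0).card = n ∧
      (Finset.univ.filter fun m => h m = p).card = n ∧ 2 * n ≤ M ∧ M ≤ 3 * n := by
  have hsq : 0 < √ρ := Real.sqrt_pos.2 hρ
  have hsq2 : √ρ ^ 2 = ρ := Real.sq_sqrt hρ.le
  have lip : ∀ (N : ℕ) (s : ℝ) (n p : ℕ) (i j : Fin (N + 1)), pathGossip N s i j ≠ 0 →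
      min (i + 1 - n) p ≤ min (j + 1 - n) p + 1 ∧ min (j + 1 - n) p ≤ min (i + 1 - n) p + 1 := by
    intro N s n p i j hij
    rcases eq_or_ne i j with rfl | hne
    · omega
    · rw [pathGossip_apply_of_ne s hne] at hij
      have : (pathGraph (N + 1)).Adj i j := by
        by_contra h
        simp [h] at hij
      rw [pathGraph_adj] at this
      omega
  -- For such large `ρ` the required distance is below `1` and the floor used in the other case
  -- would be `0`; two agents suffice.
  by_cases hc : 1 < 6 * √ρ
  · obtain ⟨hW, hgap⟩ := exists_pathGossip_two hρ hρ1
    refine ⟨2, le_rfl, _, _, hW, fun i => min (i + 1 - 1) 1, 1, 1, pathGraph_connected 1, hgap,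
      one_pos, ?_, fun m => min_le_right _ _, lip 1 _ 1 1, by decide, by decide, le_rfl,
      by norm_num⟩
    rw [div_le_iff₀ (by positivity)]
    push_cast
    linarith
  · set n := ⌊1 / (6 * √ρ)⌋₊ with hn
    have hn1 : 1 ≤ n := by
      rw [hn, Nat.one_le_floor_iff, le_div_iff₀ (by positivity)]
      linarith
    have hnle : (n : ℝ) ≤ 1 / (6 * √ρ) := Nat.floor_le (by positivity)
    have hnlt : 1 / (6 * √ρ) < n + 1 := Nat.lt_floor_add_one _
    obtain ⟨N, hN⟩ : ∃ N, 3 * n = N + 1 := ⟨3 * n - 1, by omega⟩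
    have hNc : (N : ℝ) + 1 = 3 * n := by exact_mod_cast hN.symm
    obtain ⟨s, hW, hgap⟩ := exists_pathGossip (N := N) hρ (by omega) (by
      rw [le_div_iff₀ (by positivity)] at hnle
      rw [hNc]
      have : (n * (6 * √ρ)) ^ 2 ≤ 1 := pow_le_one₀ (by positivity) hnle
      calc 4 * (3 * (n : ℝ)) ^ 2 * ρ = (n * (6 * √ρ)) ^ 2 := by
            rw [mul_pow, mul_pow, mul_pow, hsq2]
            ring
        _ ≤ 1 := this)
    -- The path has `3 * n` vertices in three blocks of `n`. Truncated subtraction gives height `0`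
    -- on the first block, heights `1, …, n` on the middle one and `n + 1` on the last.
    refine ⟨N + 1, by omega, _, _, hW, fun i => min (i + 1 - n) (n + 1), n + 1, n,
      pathGraph_connected N, hgap, by omega, by push_cast; exact hnlt.le,
      fun m => min_le_right _ _, lip N s n (n + 1), ?_, ?_, by omega, by omega⟩
    · have : (Finset.univ.filter fun i : Fin (N + 1) => min (i + 1 - n) (n + 1) = 0) =
          Finset.Iio (⟨n, by omega⟩ : Fin (N + 1)) := by
        ext i
        simp only [Finset.mem_filter, Finset.mem_univ, true_and, Finset.mem_Iio, Fin.lt_def]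
        omega
      rw [this, Fin.card_Iio]
    · have : (Finset.univ.filter fun i : Fin (N + 1) => min (i + 1 - n) (n + 1) = n + 1) =
          Finset.Ici (⟨2 * n, by omega⟩ : Fin (N + 1)) := by
        ext i
        simp only [Finset.mem_filter, Finset.mem_univ, true_and, Finset.mem_Ici, Fin.le_def]
        omega
      rw [this, Fin.card_Ici]
      simp only
      omega

end Path

end Network

/-! ### Weighted permutation operators, the decay ratio and the final logarithmic estimate. -/

/-- The operator `x ↦ (cᵢ x_{σ i})ᵢ`. -/
def permOp (c : Fin d → ℝ) (σ : Equiv.Perm (Fin d)) : Vec d →L[ℝ] Vec d :=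
  LinearMap.toContinuousLinearMap
    { toFun := fun x => WithLp.toLp 2 fun i => c i * x (σ i)
      map_add' := fun x y => by ext i; simp [mul_add]
      map_smul' := fun a x => by ext i; simp; ring }

@[simp]
lemma permOp_apply (c : Fin d → ℝ) (σ : Equiv.Perm (Fin d)) (x : Vec d) (i : Fin d) :
    permOp c σ x i = c i * x (σ i) := rfl

lemma norm_permOp_le {c : Fin d → ℝ} {C : ℝ} (hC : 0 ≤ C) (hc : ∀ i, |c i| ≤ C)
    (σ : Equiv.Perm (Fin d)) : ‖permOp c σ‖ ≤ C := by
  refine ContinuousLinearMap.opNorm_le_bound _ hC fun x => ?_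
  refine le_of_sq_le_sq ?_ (by positivity)
  rw [mul_pow, EuclideanSpace.real_norm_sq_eq, EuclideanSpace.real_norm_sq_eq,
    ← Equiv.sum_comp σ (fun i => x i ^ 2), Finset.mul_sum]
  refine Finset.sum_le_sum fun i _ => ?_
  rw [permOp_apply, mul_pow]
  exact mul_le_mul_of_nonneg_right (sq_le_sq.2 (by rw [abs_of_nonneg hC]; exact hc i)) (sq_nonneg _)

lemma adjoint_permOp (c : Fin d → ℝ) (σ : Equiv.Perm (Fin d)) :
    ContinuousLinearMap.adjoint (permOp c σ) = permOp (fun i => c (σ.symm i)) σ.symm := by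
  symm
  rw [ContinuousLinearMap.eq_adjoint_iff]
  intro x y
  simp only [PiLp.inner_apply, permOp_apply]
  rw [← Equiv.sum_comp σ]
  refine Finset.sum_congr rfl fun i _ => ?_
  simp
  ring

lemma permOp_mem_coordSubspace {c : Fin d → ℝ} {σ : Equiv.Perm (Fin d)} {pos pos' : Fin d → ℕ}
    {j : ℕ} (h : ∀ i, j < pos i → c i = 0 ∨ j < pos' (σ i)) :
    ∀ x ∈ coordSubspace pos' j, permOp c σ x ∈ coordSubspace pos j := by
  intro x hx i hi
  rw [permOp_apply]
  rcases h i hi with h | h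
  · simp [h]
  · simp [hx _ h]

lemma exists_quadratic_root {s : ℝ} (hs : 0 < s) : ∃ r : ℝ, 0 < r ∧ r < 1 ∧ 1 - r ^ 2 = s * r := by
  have h1 : √(s ^ 2 + 4) ^ 2 = s ^ 2 + 4 := Real.sq_sqrt (by positivity)
  have h0 : 0 ≤ √(s ^ 2 + 4) := Real.sqrt_nonneg _
  have h2 : s < √(s ^ 2 + 4) := by nlinarith
  have h3 : √(s ^ 2 + 4) < s + 2 := by nlinarith
  refine ⟨(√(s ^ 2 + 4) - s) / 2, by linarith, by linarith, ?_⟩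
  nlinarith

/-- Taking logarithms of `hZ` bounds `log (Z / ε)` by a multiple of `(k / p) * (μ / δ)` plus a
constant. The factor `216 = 24 * 6 * (3 / 2)` collects `hΛ2`, `1 / √ρ ≤ 6 * p` and `1 + δ / μ ≤ (3 /
2) * (δ / μ)`. -/
lemma rounds_lower_bound {μ δ ρ r Z ε : ℝ} {k p : ℕ} (hμ : 0 < μ) (hδ : 2 * μ ≤ δ) (hρ : 0 < ρ)
    (hp : 1 / (6 * √ρ) ≤ p) (hr : 0 < r) (hr1 : r < 1) (hrδ : 1 / r ≤ 1 + 6 * μ / δ)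
    (hε : 0 < ε) (hZ : (r ^ 2) ^ (k / p + 3) * Z ≤ 3 * ε) (hεZ : ε ≤ Real.exp (-40) * Z) :
    1 / 216 * ((1 / √ρ) * (1 + δ / μ) * Real.log (Z / ε)) ≤ k := by
  have hsq : 0 < √ρ := Real.sqrt_pos.2 hρ
  have hp0 : (0 : ℝ) < p := lt_of_lt_of_le (by positivity) hp
  have hδ0 : 0 < δ := by linarith
  have hZ0 : 0 < Z := by
    by_contra h
    have := mul_nonpos_of_nonneg_of_nonpos (Real.exp_pos (-40)).le (not_lt.1 h)
    linarith
  set Λ := Real.log (Z / ε) with hΛ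
  have hΛ40 : 40 ≤ Λ := by
    rw [hΛ, Real.le_log_iff_exp_le (by positivity), le_div_iff₀ hε]
    have : Real.exp 40 * (Real.exp (-40) * Z) = Z := by
      rw [← mul_assoc, ← Real.exp_add]; simp
    rw [← this]
    exact mul_le_mul_of_nonneg_left hεZ (Real.exp_pos _).le
  have hlogr : Real.log (1 / r) ≤ 6 * μ / δ := by
    have := Real.log_le_sub_one_of_pos (x := 1 / r) (by positivity)
    linarith
  have hlogr0 : 0 ≤ Real.log (1 / r) := Real.log_nonneg (by rw [le_div_iff₀ hr]; linarith)
  have hlog3 : Real.log 3 ≤ 2 := by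
    have := Real.log_le_sub_one_of_pos (x := 3) (by norm_num)
    linarith
  have hkp : ((k / p : ℕ) : ℝ) ≤ k / p := Nat.cast_div_le
  have hΛ1 : Λ ≤ Real.log 3 + (2 * ((k / p : ℕ) + 3 : ℕ)) * Real.log (1 / r) := by
    have hle : Z / ε ≤ 3 * (1 / r) ^ (2 * (k / p + 3)) := by
      rw [div_le_iff₀ hε, one_div, inv_pow, pow_mul]
      have hq : 0 < (r ^ 2) ^ (k / p + 3) := by positivity
      rw [mul_right_comm, ← div_eq_mul_inv, le_div_iff₀ hq]
      linarith
    have := Real.log_le_log (by positivity) hle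
    rw [Real.log_mul (by norm_num) (by positivity), Real.log_pow] at this
    push_cast at this ⊢
    exact this
  have hμδ : μ / δ ≤ 1 / 2 := by rw [div_le_iff₀ hδ0]; linarith
  -- The additive part is at most `2 + 36 * (1 / 2) = 20`, which is at most `Λ / 2` because `Λ ≥
  -- 40`; this is the reason for `exp (-40)`.
  have hΛ2 : Λ ≤ 24 * (k / p) * (μ / δ) := by
    have h1 : (2 * (((k / p : ℕ) : ℝ) + 3)) * Real.log (1 / r) ≤
        (2 * ((k : ℝ) / p + 3)) * (6 * μ / δ) :=
      mul_le_mul (by linarith) hlogr hlogr0 (by positivity)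
    push_cast at hΛ1
    have h2 : (2 * ((k : ℝ) / p + 3)) * (6 * μ / δ) = 12 * (k / p) * (μ / δ) + 36 * (μ / δ) := by
      ring
    linarith
  have h3 : Λ * (p * (δ / μ)) ≤ 24 * k := by
    calc Λ * (p * (δ / μ)) ≤ (24 * (k / p) * (μ / δ)) * (p * (δ / μ)) :=
          mul_le_mul_of_nonneg_right hΛ2 (by positivity)
      _ = 24 * k := by field_simp
  have h4 : 1 / √ρ ≤ 6 * p := by
    rw [div_le_iff₀ (by positivity)] at hp ⊢
    linarith
  have h5 : 1 + δ / μ ≤ 3 / 2 * (δ / μ) := by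
    have : 2 ≤ δ / μ := by rw [le_div_iff₀ hμ]; linarith
    linarith
  have h6 : (1 / √ρ) * (1 + δ / μ) ≤ (6 * p) * (3 / 2 * (δ / μ)) :=
    mul_le_mul h4 h5 (by positivity) (by positivity)
  have h7 := mul_le_mul_of_nonneg_right h6 (by linarith : 0 ≤ Λ)
  linarith

/-! ### The bilinear chain -/

section Bilinear

variable {N : ℕ}

/-- Weights of the edges `xᵢ – yᵢ` of the chain. -/
def diagWeight (N : ℕ) (η r : ℝ) (i : Fin (N + 1)) : ℝ :=
  if i = Fin.last N then η * √(1 - r ^ 2) else η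

/-- Weights of the edges `yᵢ₋₁ – xᵢ` of the chain. -/
def shiftWeight (N : ℕ) (η : ℝ) (i : Fin (N + 1)) : ℝ := if i = 0 then 0 else -η

/-- The edges `xᵢ – yᵢ`. -/
def diagCoupling (N : ℕ) (η r : ℝ) : Vec (N + 1) →L[ℝ] Vec (N + 1) :=
  permOp (diagWeight N η r) 1

/-- The edges `yᵢ₋₁ – xᵢ`. -/
def shiftCoupling (N : ℕ) (η : ℝ) : Vec (N + 1) →L[ℝ] Vec (N + 1) :=
  permOp (shiftWeight N η) (Equiv.subRight 1)

/-- The `x`-part of the solution. -/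
def chainX (N : ℕ) (r : ℝ) : Vec (N + 1) := WithLp.toLp 2 fun i => (r ^ 2) ^ (i : ℕ)

/-- The `y`-part of the solution. -/
def chainY (N : ℕ) (r : ℝ) : Vec (N + 1) := WithLp.toLp 2 fun i =>
  if i = Fin.last N then r * (r ^ 2) ^ N / √(1 - r ^ 2) else r * (r ^ 2) ^ (i : ℕ)

lemma val_subRight_one {i : Fin (N + 1)} (hi : i ≠ 0) :
    ((Equiv.subRight (1 : Fin (N + 1)) i : Fin (N + 1)) : ℕ) = i - 1 := by
  rw [Equiv.subRight_apply]
  exact Fin.val_sub_one_of_ne_zero hi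

lemma subRight_one_symm (i : Fin (N + 1)) :
    (Equiv.subRight (1 : Fin (N + 1))).symm i = i + 1 := rfl

lemma norm_diagCoupling_le {η r : ℝ} (hη : 0 ≤ η) : ‖diagCoupling N η r‖ ≤ η := by
  refine norm_permOp_le hη (fun i => ?_) _
  unfold diagWeight
  split_ifs
  · rw [abs_of_nonneg (by positivity)]
    have : √(1 - r ^ 2) ≤ 1 := Real.sqrt_le_one.2 (by nlinarith [sq_nonneg r])
    nlinarith
  · rw [abs_of_nonneg hη]

lemma norm_shiftCoupling_le {η : ℝ} (hη : 0 ≤ η) : ‖shiftCoupling N η‖ ≤ η := by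
  refine norm_permOp_le hη (fun i => ?_) _
  unfold shiftWeight
  split_ifs
  · simpa using hη
  · rw [abs_neg, abs_of_nonneg hη]

lemma preserves_zero (X Y : Submodule ℝ (Vec d)) : Preserves 0 0 X Y :=
  ⟨fun _ _ => X.zero_mem, fun _ _ => X.zero_mem, fun _ _ => by simp⟩

/-- With `xᵢ` at position `2i` and `yᵢ` at `2i + 1`, an initial segment ending at an odd position is
a union of pairs `xᵢ, yᵢ`. -/
lemma preserves_diagCoupling (η r : ℝ) {j : ℕ} (hj : Odd j) :
    Preserves 0 (diagCoupling N η r) (coordSubspace (fun i => 2 * (i : ℕ)) j)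
      (coordSubspace (fun i => 2 * (i : ℕ) + 1) j) where
  xx _ _ := Submodule.zero_mem _
  xy := permOp_mem_coordSubspace fun i hi => Or.inr (by simp; omega)
  yx := by
    rw [diagCoupling, adjoint_permOp]
    refine permOp_mem_coordSubspace fun i hi => Or.inr ?_
    obtain ⟨l, rfl⟩ := hj
    change _ < 2 * (i : ℕ)
    omega

lemma preserves_shiftCoupling (η : ℝ) {j : ℕ} (hj : Even j) :
    Preserves 0 (shiftCoupling N η) (coordSubspace (fun i => 2 * (i : ℕ)) j)
      (coordSubspace (fun i => 2 * (i : ℕ) + 1) j) where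
  xx _ _ := Submodule.zero_mem _
  xy := permOp_mem_coordSubspace fun i hi => by
    obtain ⟨l, rfl⟩ := hj
    by_cases h0 : i = 0
    · exact Or.inl (by simp [shiftWeight, h0])
    · refine Or.inr ?_
      rw [val_subRight_one h0]
      omega
  yx := by
    rw [shiftCoupling, adjoint_permOp]
    refine permOp_mem_coordSubspace fun i hi => ?_
    rw [subRight_one_symm]
    by_cases h0 : i = Fin.last N
    · exact Or.inl (by simp [shiftWeight, h0])
    · refine Or.inr ?_
      rw [Fin.val_add_one_of_lt (lt_of_le_of_ne (Fin.le_last i) h0)]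
      omega

variable {μ η r θ : ℝ}

lemma chain_eq_x (hr : 0 < r) (hr1 : r < 1) (h : θ * η * (1 - r ^ 2) = μ * r) {i : Fin (N + 1)}
    (hi : i ≠ 0) :
    (μ • chainX N r + θ • (diagCoupling N η r + shiftCoupling N η) (chainY N r)) i = 0 := by
  have hs : 0 < √(1 - r ^ 2) := Real.sqrt_pos.2 (by nlinarith)
  have e1 : diagWeight N η r i * chainY N r i = η * (r * (r ^ 2) ^ (i : ℕ)) := by
    by_cases hl : i = Fin.last N
    · simp [diagWeight, chainY, hl]
      field_simp
    · simp [diagWeight, chainY, hl]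
  have hsub := val_subRight_one hi
  have hne : Equiv.subRight (1 : Fin (N + 1)) i ≠ Fin.last N := fun he => by
    rw [he] at hsub
    have := i.2
    simp at hsub
    omega
  obtain ⟨l, hl⟩ : ∃ l, (i : ℕ) = l + 1 :=
    ⟨i - 1, by have : (i : ℕ) ≠ 0 := fun h => hi (Fin.ext h); omega⟩
  have e2 : shiftWeight N η i * chainY N r (Equiv.subRight (1 : Fin (N + 1)) i) =
      -η * (r * (r ^ 2) ^ l) := by
    rw [shiftWeight, if_neg hi]
    change _ * (if _ then _ else _) = _
    rw [if_neg hne, hsub, hl, Nat.add_sub_cancel]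
  have e3 : chainX N r i = (r ^ 2) ^ (l + 1) := by rw [← hl]; rfl
  simp only [PiLp.add_apply, PiLp.smul_apply, _root_.add_apply, smul_eq_mul, diagCoupling,
    shiftCoupling, permOp_apply, Equiv.Perm.one_apply]
  rw [e1, e2, e3, hl]
  linear_combination -(r ^ 2) ^ l * r * h

/-- The last `yᵢ` has no successor in `x`. Scaling its link by `√(1 - r ^ 2)` and its value by the
inverse leaves the `x`-equation unchanged and makes the last `y`-equation the same relation `h`, so
the truncated geometric sequence is an exact solution. -/
lemma chain_eq_y (hr : 0 < r) (hr1 : r < 1) (h : θ * η * (1 - r ^ 2) = μ * r) :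
    ContinuousLinearMap.adjoint (θ • (diagCoupling N η r + shiftCoupling N η)) (chainX N r) =
      μ • chainY N r := by
  have hs : 0 < √(1 - r ^ 2) := Real.sqrt_pos.2 (by nlinarith)
  have hs2 : √(1 - r ^ 2) ^ 2 = 1 - r ^ 2 := Real.sq_sqrt (by nlinarith)
  ext i
  simp only [map_smulₛₗ, map_add, conj_trivial, diagCoupling, shiftCoupling, adjoint_permOp,
    PiLp.add_apply, PiLp.smul_apply, _root_.add_apply, _root_.smul_apply, smul_eq_mul, permOp_apply,
    subRight_one_symm]
  change θ * (diagWeight N η r i * (r ^ 2) ^ (i : ℕ) + shiftWeight N η (i + 1) *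
    (r ^ 2) ^ ((i + 1 : Fin (N + 1)) : ℕ)) = _
  by_cases hl : i = Fin.last N
  · subst hl
    simp only [diagWeight, shiftWeight, chainY, Fin.last_add_one, if_true, Fin.val_last, zero_mul,
      add_zero]
    field_simp
    rw [hs2]
    linear_combination h
  · have hlt : i < Fin.last N := lt_of_le_of_ne (Fin.le_last i) hl
    have hv := Fin.val_add_one_of_lt hlt
    have hne : i + 1 ≠ 0 := fun h0 => by
      rw [h0] at hv
      simp at hv
    rw [hv, shiftWeight, if_neg hne, diagWeight, if_neg hl]
    change _ = μ * (if _ then _ else _)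
    rw [if_neg hl]
    linear_combination (r ^ 2) ^ (i : ℕ) * h

lemma geom_Ico_sum (q : ℝ) {m n : ℕ} (hmn : m ≤ n) :
    (1 - q ^ 2) * ∑ k ∈ Finset.Ico m n, (q ^ k) ^ 2 = (q ^ m) ^ 2 - (q ^ n) ^ 2 := by
  induction n, hmn using Nat.le_induction with
  | base => simp
  | succ n hn ih =>
    rw [Finset.sum_Ico_succ_top hn, mul_add, ih]
    ring

/-- A geometric sum plus the rescaled last term. The factor `1 - (r ^ 2) ^ 2` is kept on the left
because it also appears in the norm bounds and cancels from the final comparison. -/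
lemma sum_chainY_tail (hr1 : r ^ 2 < 1) {i₀ : ℕ} (hi : i₀ ≤ N) :
    (1 - (r ^ 2) ^ 2) * ∑ i : Fin (N + 1), (if i₀ ≤ i then chainY N r i ^ 2 else 0) =
      r ^ 2 * (((r ^ 2) ^ i₀) ^ 2 + (r ^ 2) * ((r ^ 2) ^ N) ^ 2) := by
  have hs : 0 < √(1 - r ^ 2) := Real.sqrt_pos.2 (by linarith)
  have hs2 : √(1 - r ^ 2) ^ 2 = 1 - r ^ 2 := Real.sq_sqrt (by linarith)
  have hlast : chainY N r (Fin.last N) = r * (r ^ 2) ^ N / √(1 - r ^ 2) := if_pos rfl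
  have hcast : ∀ e : Fin N, chainY N r e.castSucc = r * (r ^ 2) ^ (e : ℕ) := fun e =>
    if_neg (Fin.castSucc_lt_last e).ne
  rw [Fin.sum_univ_castSucc, hlast]
  simp only [hcast, Fin.val_castSucc, Fin.val_last, if_pos hi]
  rw [← Finset.sum_range (fun k => if i₀ ≤ k then (r * (r ^ 2) ^ k) ^ 2 else 0),
    ← Finset.sum_filter]
  have hfil : (Finset.range N).filter (fun k => i₀ ≤ k) = Finset.Ico i₀ N := by
    ext k
    simp [and_comm]
  have hg := geom_Ico_sum (r ^ 2) hi
  rw [hfil, div_pow, hs2]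
  simp only [mul_pow r]
  rw [← Finset.mul_sum, mul_add]
  have h1 : (1 - (r ^ 2) ^ 2) * (r ^ 2 * ((r ^ 2) ^ N) ^ 2 / (1 - r ^ 2)) =
      (1 + r ^ 2) * (r ^ 2 * ((r ^ 2) ^ N) ^ 2) := by
    have : 1 - r ^ 2 ≠ 0 := by linarith
    field_simp
    ring
  rw [h1]
  linear_combination r ^ 2 * hg

lemma norm_chainX (r : ℝ) : (1 - (r ^ 2) ^ 2) * ‖chainX N r‖ ^ 2 ≤ 1 := by
  have hg := geom_Ico_sum (r ^ 2) (Nat.zero_le (N + 1))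
  rw [EuclideanSpace.real_norm_sq_eq]
  have : ∑ i : Fin (N + 1), chainX N r i ^ 2 = ∑ k ∈ Finset.Ico 0 (N + 1), ((r ^ 2) ^ k) ^ 2 := by
    rw [← Finset.range_eq_Ico, Finset.sum_range]
    rfl
  rw [this, hg]
  nlinarith [sq_nonneg ((r ^ 2) ^ (N + 1))]

lemma norm_chainY (hr1 : r ^ 2 < 1) : (1 - (r ^ 2) ^ 2) * ‖chainY N r‖ ^ 2 ≤ 2 := by
  have h := sum_chainY_tail (N := N) hr1 (Nat.zero_le N)
  simp only [Nat.zero_le, if_true, pow_zero] at h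
  rw [EuclideanSpace.real_norm_sq_eq, h]
  have h1 : (r ^ 2) ^ N ≤ 1 := pow_le_one₀ (sq_nonneg _) hr1.le
  have h2 : ((r ^ 2) ^ N) ^ 2 ≤ 1 := pow_le_one₀ (by positivity) h1
  nlinarith [sq_nonneg r, sq_nonneg ((r ^ 2) ^ N)]

lemma dist_chainY_ge (hr1 : r ^ 2 < 1) {i₀ : ℕ} (hi : i₀ ≤ N) {y : Vec (N + 1)}
    (hy : ∀ i : Fin (N + 1), i₀ ≤ i → y i = 0) :
    r ^ 2 * ((r ^ 2) ^ i₀) ^ 2 ≤ (1 - (r ^ 2) ^ 2) * ‖y - chainY N r‖ ^ 2 := by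
  have h := sum_chainY_tail (N := N) hr1 hi
  have hle : ∑ i : Fin (N + 1), (if i₀ ≤ i then chainY N r i ^ 2 else 0) ≤
      ‖y - chainY N r‖ ^ 2 := by
    rw [EuclideanSpace.real_norm_sq_eq]
    refine Finset.sum_le_sum fun i _ => ?_
    split_ifs with hi
    · simp [hy i hi]
    · positivity
  have h1 : 0 ≤ 1 - (r ^ 2) ^ 2 := by nlinarith [sq_nonneg r]
  have h2 := mul_le_mul_of_nonneg_left hle h1
  have h3 : 0 ≤ r ^ 2 * ((r ^ 2) * ((r ^ 2) ^ N) ^ 2) := by positivity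
  linarith

end Bilinear

/-! ### Membership of a family of quadratics in the problem class. -/

lemma quad_family_spec (hM : 0 < M) {L μ δ : ℝ} (hμ : 0 < μ) (hδ : 0 ≤ δ)
    {P Q : Fin M → Vec d →L[ℝ] Vec d} {b xs ys : Vec d}
    (hP : ∀ m, (P m : Vec d →ₗ[ℝ] Vec d).IsPositive) (hL : ∀ m, μ + ‖P m‖ + ‖Q m‖ ≤ L)
    (hPδ : ∀ m, ‖P m - opAverage P‖ ≤ δ) (hQδ : ∀ m, ‖Q m - opAverage Q‖ ≤ δ)
    (hx : μ • xs + opAverage P xs + opAverage Q ys = b)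
    (hy : ContinuousLinearMap.adjoint (opAverage Q) xs = μ • ys) :
    let f : Fin M → SFun d := fun m => quad μ (P m) (Q m) b
    (∀ m, TwiceDifferentiable (f m) ∧ Smooth L (f m) ∧ StronglyConvexConcave μ (f m)) ∧
      StronglyConvexConcave μ (average f) ∧ Related δ f ∧ IsSolution (average f) xs ys := by
  intro f
  refine ⟨fun m => ⟨twiceDifferentiable_quad _ _ _ _, smooth_quad _ _ _ (hP m).1 hμ.le (hL m),
    stronglyConvexConcave_quad _ _ _ (hP m)⟩, ?_, related_quad hM hδ hP hPδ hQδ, ?_⟩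
  · rw [average_quad hM]
    exact stronglyConvexConcave_quad _ _ _ (isPositive_opAverage hP)
  · rw [average_quad hM]
    exact isSolution_quad _ _ _ (isPositive_opAverage hP) hμ.le hx hy

lemma isPositive_zero : ((0 : Vec d →L[ℝ] Vec d) : Vec d →ₗ[ℝ] Vec d).IsPositive :=
  ⟨fun x y => by simp, fun x => by simp⟩

lemma isPositive_splitOp {h : Fin M → ℕ} {p : ℕ} {T₀ T₁ : Vec d →L[ℝ] Vec d}
    (h₀ : (T₀ : Vec d →ₗ[ℝ] Vec d).IsPositive) (h₁ : (T₁ : Vec d →ₗ[ℝ] Vec d).IsPositive)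
    (m : Fin M) : (splitOp h p T₀ T₁ m : Vec d →ₗ[ℝ] Vec d).IsPositive := by
  unfold splitOp
  split_ifs
  exacts [h₀, h₁, isPositive_zero]

lemma opAverage_const (hM : 0 < M) (T : Vec d →L[ℝ] Vec d) :
    opAverage (fun _ : Fin M => T) = T := by
  have : (M : ℝ) ≠ 0 := by positivity
  simp only [opAverage, Finset.sum_const, Finset.card_univ, Fintype.card_fin]
  rw [← Nat.cast_smul_eq_nsmul ℝ, smul_smul, one_div, inv_mul_cancel₀ this, one_smul]

/-- A vector supported on the first coordinate lies in every level of the chain. -/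
lemma single_mem_coordSubspace {N : ℕ} {pos : Fin (N + 1) → ℕ} (h0 : pos 0 = 0) {b : Vec (N + 1)}
    (hb : ∀ i, i ≠ 0 → b i = 0) : b ∈ coordSubspace pos 0 := by
  intro i hi
  refine hb i ?_
  rintro rfl
  omega

/-- For `2μ ≤ δ`: the bilinear chain split between the two sides of the network. -/
lemma exists_bilinear_problem {L μ δ ρ : ℝ} (hμ : 0 < μ) (hδμ : 2 * μ ≤ δ) (hδL : δ < L)
    (hρ : 0 < ρ) (K : ℕ) {M n p : ℕ} (hM : 2 ≤ M) {W : Matrix (Fin M) (Fin M) ℝ} {h : Fin M → ℕ}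
    (hp : 0 < p) (hpρ : 1 / (6 * √ρ) ≤ p) (hh : ∀ m, h m ≤ p)
    (hW : ∀ i j, W i j ≠ 0 → h i ≤ h j + 1 ∧ h j ≤ h i + 1)
    (h0 : (Finset.univ.filter fun m => h m = 0).card = n)
    (h1 : (Finset.univ.filter fun m => h m = p).card = n) (hn : M ≤ 3 * n) :
    ∃ (d : ℕ) (f : Fin M → SFun d) (xs ys : Vec d),
      ((∀ m, TwiceDifferentiable (f m) ∧ Smooth L (f m) ∧ StronglyConvexConcave μ (f m)) ∧
        StronglyConvexConcave μ (average f) ∧ Related δ f ∧ IsSolution (average f) xs ys) ∧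
      xs ≠ 0 ∧ ys ≠ 0 ∧
      ∀ k ≤ K, ∀ x y : Vec d, IsOutput f W k x y →
        ∀ ε : ℝ, 0 < ε → ‖x - xs‖ ^ 2 + ‖y - ys‖ ^ 2 ≤ ε → ∀ Z : ℝ,
          Z ≤ ‖xs‖ ^ 2 + ‖ys‖ ^ 2 → ε ≤ Real.exp (-40) * Z →
            1 / 216 * ((1 / √ρ) * (1 + δ / μ) * Real.log (Z / ε)) ≤ (k : ℝ) := by
  have hM0 : (0 : ℝ) < M := by positivity
  have hδ : 0 < δ := by linarith
  set θ : ℝ := n / M with hθ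
  have hθ3 : 1 / 3 ≤ θ := by
    rw [hθ, div_le_div_iff₀ (by norm_num) hM0]
    have : (M : ℝ) ≤ 3 * n := by exact_mod_cast hn
    linarith
  -- Half of `δ` keeps each `Q m` within `δ` of the average by the triangle inequality, and `μ + η ≤
  -- δ < L` gives smoothness.
  set η : ℝ := δ / 2 with hη
  have hη0 : 0 < η := by positivity
  have ha : 0 < θ * η := mul_pos (by linarith) hη0
  obtain ⟨r, hr, hr1, hrs⟩ := exists_quadratic_root (s := μ / (θ * η)) (by positivity)
  have hr2 : r ^ 2 < 1 := by nlinarith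
  have hrμ : θ * η * (1 - r ^ 2) = μ * r := by
    rw [hrs]
    field_simp
  have hrδ : 1 / r ≤ 1 + 6 * μ / δ := by
    have e : 1 / r = r + μ / (θ * η) := by
      rw [div_eq_iff hr.ne']
      linear_combination hrs
    have : μ / (θ * η) ≤ 6 * μ / δ := by
      rw [div_le_div_iff₀ ha hδ]
      have : δ ≤ 6 * (θ * η) := by rw [hη]; nlinarith
      nlinarith
    linarith
  set N := K + 2
  set Q := splitOp h p (diagCoupling N η r) (shiftCoupling N η)
  set P : Fin M → Vec (N + 1) →L[ℝ] Vec (N + 1) := fun _ => 0 with hPdef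
  have hP : ∀ m, (P m : Vec (N + 1) →ₗ[ℝ] Vec (N + 1)).IsPositive := fun _ => isPositive_zero
  have hPavg : opAverage P = 0 := opAverage_const (by omega) 0
  have hQavg : opAverage Q = θ • (diagCoupling N η r + shiftCoupling N η) :=
    opAverage_splitOp hp h0 h1 _ _
  have hQn : ∀ m, ‖Q m‖ ≤ η := splitOp_ind (R := fun T => ‖T‖ ≤ η) (norm_diagCoupling_le hη0.le)
    (norm_shiftCoupling_le hη0.le) (by simpa using hη0.le)
  set b : Vec (N + 1) := μ • chainX N r + opAverage P (chainX N r) + opAverage Q (chainY N r)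
  have hb : ∀ i, i ≠ 0 → b i = 0 := fun i hi => by
    have := chain_eq_x (θ := θ) hr hr1 hrμ hi
    simpa [b, hPavg, hQavg] using this
  have hbm : b ∈ coordSubspace (fun i : Fin (N + 1) => 2 * (i : ℕ)) 0 :=
    single_mem_coordSubspace rfl hb
  have hchain : SplitChain h p P Q (fun i : Fin (N + 1) => 2 * (i : ℕ))
      (fun i => 2 * (i : ℕ) + 1) := by
    constructor
    · intro m j hm hj
      simp only [Q, splitOp, if_neg hm]
      split_ifs
      · exact preserves_diagCoupling η r hj
      · exact preserves_zero _ _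
    · intro m j hm hj
      simp only [Q, splitOp, if_neg hm]
      split_ifs
      · exact preserves_shiftCoupling η hj
      · exact preserves_zero _ _
  have hx0 : chainX N r 0 = 1 := by simp [chainX]
  have hy0 : chainY N r 0 = r := by
    have : (0 : Fin (N + 1)) ≠ Fin.last N := (Fin.last_pos' (n := N)).ne
    simp [chainY, this]
  refine ⟨N + 1, fun m => quad μ (P m) (Q m) b, chainX N r, chainY N r,
    quad_family_spec (by omega) hμ hδ.le hP (fun m => ?_) (fun m => ?_) (fun m => ?_) rfl ?_,
    fun h => ?_, fun h => ?_, ?_⟩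
  · have := hQn m
    simp only [hPdef, norm_zero]
    linarith
  · rw [hPavg, sub_zero, hPdef, norm_zero]
    exact hδ.le
  · refine (norm_sub_le _ _).trans ?_
    have := norm_opAverage_le (by omega) hQn
    linarith [hQn m]
  · rw [hQavg]
    exact chain_eq_y hr hr1 hrμ
  · rw [h] at hx0
    simp at hx0
  · rw [h] at hy0
    exact hr.ne hy0
  · intro k hk x y hout ε hε hdist Z hZ hεZ
    refine rounds_lower_bound hμ hδμ hρ hpρ hr hr1 hrδ hε ?_ hεZ
    set j := k / p + 1 with hj
    have hkj : k < j * p := by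
      rw [hj, add_mul, one_mul]
      exact Nat.lt_div_mul_add hp
    have hjK : j ≤ K + 1 := by
      have := Nat.div_le_self k p
      omega
    have hy := (isOutput_mem hμ hp hW hh hP hchain hbm hkj hout).2
    -- Position `2i + 1` exceeds `j` as soon as `i ≥ (j + 1) / 2`, so the output misses this tail of
    -- `y*`.
    have hd := dist_chainY_ge (N := N) hr2 (i₀ := (j + 1) / 2) (by omega) (y := y)
      (fun i hi => hy i (by change j < 2 * (i : ℕ) + 1; omega))
    have hq1 : 0 < 1 - (r ^ 2) ^ 2 := by nlinarith [sq_nonneg r]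
    have hxn := norm_chainX (N := N) r
    have hyn := norm_chainY (N := N) hr2
    have hpow : (r ^ 2) ^ (k / p + 3) ≤ r ^ 2 * ((r ^ 2) ^ ((j + 1) / 2)) ^ 2 := by
      rw [← pow_mul (r ^ 2) _ 2, ← pow_succ']
      exact pow_le_pow_of_le_one (sq_nonneg _) hr2.le (by omega)
    have hε' : (r ^ 2) ^ (k / p + 3) ≤ (1 - (r ^ 2) ^ 2) * ε := by
      refine hpow.trans (hd.trans (mul_le_mul_of_nonneg_left ?_ hq1.le))
      linarith [sq_nonneg ‖x - chainX N r‖]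
    have hZ3 : (1 - (r ^ 2) ^ 2) * Z ≤ 3 := by
      have := mul_le_mul_of_nonneg_left hZ hq1.le
      linarith
    have hq0 : 0 ≤ (r ^ 2) ^ (k / p + 3) := by positivity
    refine le_of_mul_le_mul_left ?_ hq1
    calc (1 - (r ^ 2) ^ 2) * ((r ^ 2) ^ (k / p + 3) * Z)
        = (r ^ 2) ^ (k / p + 3) * ((1 - (r ^ 2) ^ 2) * Z) := by ring
      _ ≤ (r ^ 2) ^ (k / p + 3) * 3 := mul_le_mul_of_nonneg_left hZ3 hq0
      _ ≤ ((1 - (r ^ 2) ^ 2) * ε) * 3 := by linarith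
      _ = (1 - (r ^ 2) ^ 2) * (3 * ε) := by ring

/-! ### The chain in `x` with `y` attached to its far end -/

section Hidden

variable {N : ℕ}

/-- The involution exchanging `2i` and `2i + 1`. -/
def swapEven (N : ℕ) : Equiv.Perm (Fin (2 * N + 2)) :=
  Function.Involutive.toPerm
    (fun i => if h : i.val % 2 = 0 then ⟨i.val + 1, by omega⟩ else ⟨i.val - 1, by omega⟩) (by
      intro i
      by_cases h : i.val % 2 = 0
      · have h' : ¬ (i.val + 1) % 2 = 0 := by omega
        simp [h, h']
      · have h' : (i.val - 1) % 2 = 0 := by omega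
        simp only [h, h', dif_neg, dif_pos, not_false_eq_true]
        exact Fin.ext (by simp; omega))

/-- The involution exchanging `2i + 1` and `2i + 2` and fixing the two end points. -/
def swapOdd (N : ℕ) : Equiv.Perm (Fin (2 * N + 2)) :=
  Function.Involutive.toPerm
    (fun i => if h : i.val = 0 ∨ i.val = 2 * N + 1 then i
      else if h' : i.val % 2 = 0 then ⟨i.val - 1, by omega⟩ else ⟨i.val + 1, by omega⟩) (by
      intro i
      by_cases h : i.val = 0 ∨ i.val = 2 * N + 1
      · simp only [h, dif_pos]
      · by_cases h' : i.val % 2 = 0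
        · have b : ¬ (i.val - 1) % 2 = 0 := by omega
          have c : ¬ (i.val - 1 = 0 ∨ i.val - 1 = 2 * N + 1) := by omega
          simp only [h, h', b, c, dif_neg, dif_pos, not_false_eq_true]
          exact Fin.ext (by simp; omega)
        · have b : (i.val + 1) % 2 = 0 := by omega
          have c : ¬ (i.val + 1 = 0 ∨ i.val + 1 = 2 * N + 1) := by omega
          simp only [h, h', b, c, dif_neg, dif_pos, not_false_eq_true]
          exact Fin.ext (by simp))

lemma swapEven_symm (N : ℕ) : (swapEven N).symm = swapEven N := rfl

lemma swapOdd_symm (N : ℕ) : (swapOdd N).symm = swapOdd N := rfl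

lemma val_swapEven (i : Fin (2 * N + 2)) :
    (swapEven N i : ℕ) = if (i : ℕ) % 2 = 0 then (i : ℕ) + 1 else i - 1 := by
  change ((dite _ _ _ : Fin (2 * N + 2)) : ℕ) = _
  split_ifs <;> rfl

lemma val_swapOdd (i : Fin (2 * N + 2)) :
    (swapOdd N i : ℕ) = if (i : ℕ) = 0 ∨ (i : ℕ) = 2 * N + 1 then (i : ℕ)
      else if (i : ℕ) % 2 = 0 then (i : ℕ) - 1 else i + 1 := by
  change ((dite _ _ _ : Fin (2 * N + 2)) : ℕ) = _
  split_ifs <;> rfl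

/-- The Laplacian-like operator `ν (x - x ∘ σ)`. -/
def swapLap (ν : ℝ) (σ : Equiv.Perm (Fin d)) : Vec d →L[ℝ] Vec d :=
  ν • (ContinuousLinearMap.id ℝ _ - permOp 1 σ)

lemma swapLap_apply (ν : ℝ) (σ : Equiv.Perm (Fin d)) (x : Vec d) (i : Fin d) :
    swapLap ν σ x i = ν * (x i - x (σ i)) := by
  simp [swapLap]

lemma norm_permOp_one_le (σ : Equiv.Perm (Fin d)) : ‖permOp 1 σ‖ ≤ 1 :=
  norm_permOp_le zero_le_one (by simp) σ

lemma isPositive_swapLap {ν : ℝ} (hν : 0 ≤ ν) {σ : Equiv.Perm (Fin d)} (hσ : σ.symm = σ) :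
    (swapLap ν σ : Vec d →ₗ[ℝ] Vec d).IsPositive := by
  have hadj : ContinuousLinearMap.adjoint (permOp 1 σ) = permOp 1 σ := by
    rw [adjoint_permOp, hσ]
    rfl
  constructor
  · intro x y
    have h : inner ℝ (permOp 1 σ x) y = inner ℝ x (permOp 1 σ y) := by
      conv_lhs => rw [← hadj]
      exact ContinuousLinearMap.adjoint_inner_left _ _ _
    simp [swapLap, real_inner_smul_left, real_inner_smul_right, inner_sub_left, inner_sub_right, h]
  · intro x
    have h1 : inner ℝ (permOp 1 σ x) x ≤ ‖x‖ ^ 2 := by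
      refine (real_inner_le_norm _ _).trans ?_
      have := (permOp 1 σ).le_of_opNorm_le (norm_permOp_one_le σ) x
      nlinarith [norm_nonneg x]
    simp only [swapLap, ContinuousLinearMap.coe_coe, RCLike.re_to_real, _root_.smul_apply,
      _root_.sub_apply, ContinuousLinearMap.id_apply, real_inner_smul_left, inner_sub_left,
      real_inner_self_eq_norm_sq]
    exact mul_nonneg hν (by linarith)

lemma norm_swapLap_le {ν : ℝ} (hν : 0 ≤ ν) (σ : Equiv.Perm (Fin d)) :
    ‖swapLap ν σ‖ ≤ 2 * ν := by
  rw [swapLap, norm_smul, Real.norm_of_nonneg hν, mul_comm]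
  refine mul_le_mul_of_nonneg_right ?_ hν
  refine (norm_sub_le _ _).trans ?_
  have h1 := norm_permOp_one_le σ
  have h2 : ‖ContinuousLinearMap.id ℝ (Vec d)‖ ≤ 1 := ContinuousLinearMap.norm_id_le
  linarith

/-- The coupling `η` of the last coordinates of `x` and `y`. -/
def lastCoupling (N : ℕ) (η : ℝ) : Vec (2 * N + 2) →L[ℝ] Vec (2 * N + 2) :=
  permOp (fun i => if i = Fin.last _ then η else 0) 1

lemma adjoint_lastCoupling (η : ℝ) :
    ContinuousLinearMap.adjoint (lastCoupling N η) = lastCoupling N η := adjoint_permOp _ _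

lemma norm_lastCoupling_le {η : ℝ} (hη : 0 ≤ η) : ‖lastCoupling N η‖ ≤ η := by
  refine norm_permOp_le hη (fun i => ?_) _
  split_ifs
  · rw [abs_of_nonneg hη]
  · simpa using hη

lemma preserves_lastCoupling {P : Vec (2 * N + 2) →L[ℝ] Vec (2 * N + 2)} (η : ℝ) {j : ℕ}
    (hP : ∀ x ∈ coordSubspace (fun i : Fin (2 * N + 2) => (i : ℕ)) j,
      P x ∈ coordSubspace (fun i : Fin (2 * N + 2) => (i : ℕ)) j) :
    Preserves P (lastCoupling N η) (coordSubspace (fun i => (i : ℕ)) j)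
      (coordSubspace (fun i => (i : ℕ)) j) where
  xx := hP
  xy := permOp_mem_coordSubspace fun _ hi => Or.inr hi
  yx := by
    rw [adjoint_lastCoupling]
    exact permOp_mem_coordSubspace fun _ hi => Or.inr hi

lemma swapLap_mem_coordSubspace (ν : ℝ) {σ : Equiv.Perm (Fin d)} {pos : Fin d → ℕ} {j : ℕ}
    (h : ∀ i, j < pos i → j < pos (σ i)) :
    ∀ x ∈ coordSubspace pos j, swapLap ν σ x ∈ coordSubspace pos j := by
  intro x hx i hi
  rw [swapLap_apply, hx i hi, hx _ (h i hi)]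
  simp

/-- The `y`-part of the solution: only its last coordinate is nonzero. -/
def hiddenY (N : ℕ) (c : ℝ) : Vec (2 * N + 2) := WithLp.toLp 2 fun i =>
  if i = Fin.last _ then c else 0

/-- The `x`-part of the solution. -/
def hiddenX (N : ℕ) (q : ℝ) : Vec (2 * N + 2) := WithLp.toLp 2 fun i => q ^ (i : ℕ)

/-- Away from the ends this is the recurrence of a discrete Laplacian plus `μ`, solved by `q ^ i`
through `hq`. At the far end the right neighbour is missing; `hη` makes the coupling to `y` supply
exactly the term `θ * ν * (1 - q) * q ^ (2 * N + 1)` which that neighbour would contribute. -/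
lemma hidden_eq_x {μ θ ν η q : ℝ} (hμ : 0 < μ) (hq : θ * ν * (1 - q) ^ 2 = μ * q)
    (hη : η ^ 2 = μ * (θ * ν) * (1 - q)) {i : Fin (2 * N + 2)} (hi : i ≠ 0) :
    (μ • hiddenX N q + (θ • (swapLap ν (swapEven N) + swapLap ν (swapOdd N))) (hiddenX N q) +
      lastCoupling N η (hiddenY N (η / μ * q ^ (2 * N + 1)))) i = 0 := by
  have e : lastCoupling N η (hiddenY N (η / μ * q ^ (2 * N + 1))) i =
      if i = Fin.last _ then η * (η / μ * q ^ (2 * N + 1)) else 0 := by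
    simp only [lastCoupling, permOp_apply, Equiv.Perm.one_apply, hiddenY]
    split_ifs <;> simp [*]
  have hx : ∀ i, hiddenX N q i = q ^ (i : ℕ) := fun _ => rfl
  simp only [PiLp.add_apply, PiLp.smul_apply, _root_.add_apply, _root_.smul_apply, smul_eq_mul,
    swapLap_apply]
  rw [e]
  have hi0 : (i : ℕ) ≠ 0 := fun h => hi (Fin.ext h)
  have hlt := i.2
  obtain ⟨l, hl⟩ : ∃ l, (i : ℕ) = l + 1 := ⟨i - 1, by omega⟩
  simp only [hx, val_swapEven, val_swapOdd, hl]
  by_cases hlast : i = Fin.last _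
  · have hv : l = 2 * N := by
      have := congrArg Fin.val hlast
      rw [Fin.val_last] at this
      omega
    subst hv
    have hodd : ¬ (2 * N + 1) % 2 = 0 := by omega
    rw [if_pos hlast, if_neg hodd, if_pos (Or.inr rfl), Nat.add_sub_cancel]
    have e : η * (η / μ * q ^ (2 * N + 1)) = θ * ν * (1 - q) * q ^ (2 * N + 1) := by
      field_simp
      rw [hη]
      ring
    rw [e]
    linear_combination -q ^ (2 * N) * hq
  · have hv : l + 1 ≠ 2 * N + 1 := fun h => hlast (Fin.ext (by rw [hl, h]; rfl))
    have hends : ¬ (l + 1 = 0 ∨ l + 1 = 2 * N + 1) := by omega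
    rw [if_neg hlast, if_neg hends]
    split_ifs <;> rw [Nat.add_sub_cancel] <;> linear_combination -q ^ l * hq

lemma hidden_eq_y {μ : ℝ} (hμ : 0 < μ) (η q : ℝ) :
    ContinuousLinearMap.adjoint (lastCoupling N η) (hiddenX N q) =
      μ • hiddenY N (η / μ * q ^ (2 * N + 1)) := by
  rw [adjoint_lastCoupling]
  ext i
  simp only [lastCoupling, permOp_apply, Equiv.Perm.one_apply, PiLp.smul_apply, smul_eq_mul,
    hiddenX, hiddenY]
  by_cases hi : i = Fin.last _
  · rw [if_pos hi, if_pos hi, hi, Fin.val_last]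
    field_simp
  · rw [if_neg hi, if_neg hi]
    simp

/-- The involutions link `2i` with `2i + 1` and `2i + 1` with `2i + 2`, so they preserve initial
segments ending at odd and at even positions respectively. The coupling to `y` is diagonal and may
be shared by all agents. -/
lemma splitChain_hidden {h : Fin M → ℕ} {p : ℕ} (ν η : ℝ) :
    SplitChain h p (splitOp h p (swapLap ν (swapEven N)) (swapLap ν (swapOdd N)))
      (fun _ => lastCoupling N η) (fun i => (i : ℕ)) (fun i => (i : ℕ)) := by
  constructor
  · intro m j hm hj
    refine preserves_lastCoupling η ?_
    simp only [splitOp, if_neg hm]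
    split_ifs
    · refine swapLap_mem_coordSubspace ν fun i hi => ?_
      obtain ⟨l, rfl⟩ := hj
      rw [val_swapEven]
      split_ifs <;> omega
    · exact fun _ _ => Submodule.zero_mem _
  · intro m j hm hj
    refine preserves_lastCoupling η ?_
    simp only [splitOp, if_neg hm]
    split_ifs
    · refine swapLap_mem_coordSubspace ν fun i hi => ?_
      obtain ⟨l, rfl⟩ := hj
      rw [val_swapOdd]
      split_ifs <;> omega
    · exact fun _ _ => Submodule.zero_mem _

lemma exists_hidden_parameters {L μ δ θ : ℝ} (hμ : 0 < μ) (hδ : 0 < δ) (hμL : μ < L)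
    (hθ0 : 0 < θ) (hθ1 : θ ≤ 1) :
    ∃ ν q η : ℝ, 0 < ν ∧ 0 < q ∧ q < 1 ∧ 0 < η ∧ θ * ν * (1 - q) ^ 2 = μ * q ∧
      η ^ 2 = μ * (θ * ν) * (1 - q) ∧ μ + 2 * ν + η ≤ L ∧ 4 * ν ≤ δ := by
  obtain ⟨g, hg, hgL, hgδ⟩ : ∃ g, 0 < g ∧ g ≤ L - μ ∧ g ≤ δ :=
    ⟨min (L - μ) δ, lt_min (by linarith) hδ, min_le_left _ _, min_le_right _ _⟩
  -- This size gives both `16 * ν ≤ g` and `μ * ν ≤ g ^ 2 / 16`, hence `η ≤ g / 4`; so `2 * ν + η`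
  -- fits into `L - μ` and `4 * ν` into `δ`.
  set ν : ℝ := g ^ 2 / (16 * (μ + g)) with hν
  have hν0 : 0 < ν := by positivity
  have hνμ : (μ + g) * ν = g ^ 2 / 16 := by
    rw [hν]
    field_simp
  have hνg : 16 * ν ≤ g := by nlinarith [mul_pos hμ hν0]
  have hκ : 0 < θ * ν := by positivity
  obtain ⟨r, hr, hr1, hrs⟩ := exists_quadratic_root (s := √(μ / (θ * ν)))
    (Real.sqrt_pos.2 (by positivity))
  obtain ⟨q, hqdef⟩ : ∃ q, q = r ^ 2 := ⟨_, rfl⟩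
  rw [← hqdef] at hrs
  have hq0 : 0 < q := by rw [hqdef]; positivity
  have hq1 : q < 1 := by nlinarith
  have hq : θ * ν * (1 - q) ^ 2 = μ * q := by
    rw [hrs, mul_pow, Real.sq_sqrt (by positivity), hqdef]
    field_simp
  set η : ℝ := √(μ * (θ * ν) * (1 - q)) with hη
  have harg : 0 < μ * (θ * ν) * (1 - q) := mul_pos (by positivity) (by linarith)
  have hη0 : 0 < η := Real.sqrt_pos.2 harg
  have hη2 : η ^ 2 = μ * (θ * ν) * (1 - q) := Real.sq_sqrt harg.le
  have hηg : η ≤ g / 4 := by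
    refine le_of_sq_le_sq ?_ (by positivity)
    rw [hη2]
    have h1 : θ * ν ≤ ν := by nlinarith
    have h2 : μ * (θ * ν) ≤ μ * ν := mul_le_mul_of_nonneg_left h1 hμ.le
    have h3 : μ * (θ * ν) * (1 - q) ≤ μ * (θ * ν) :=
      mul_le_of_le_one_right (by positivity) (by linarith)
    nlinarith [mul_pos hg hν0]
  exact ⟨ν, q, η, hν0, hq0, hq1, hη0, hq, hη2, by linarith, by linarith⟩

/-- A problem in which `y*` sits at the far end of a chain in `x`, so that the `y`-part of every
output vanishes during the first `K` rounds. When `δ` or `L - μ` is small compared with `μ`, the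
error decays by a small factor in every round, so a bound for all `k ≤ K` in terms of `‖y*‖` alone
needs `‖y*‖` to be this small compared with `‖x*‖`. -/
lemma exists_hidden_problem {L μ δ : ℝ} (hμ : 0 < μ) (hδ : 0 < δ) (hμL : μ < L)
    (K : ℕ) {M n p : ℕ} (hM : 2 ≤ M) {W : Matrix (Fin M) (Fin M) ℝ} {h : Fin M → ℕ}
    (hp : 0 < p) (hh : ∀ m, h m ≤ p)
    (hW : ∀ i j, W i j ≠ 0 → h i ≤ h j + 1 ∧ h j ≤ h i + 1)
    (h0 : (Finset.univ.filter fun m => h m = 0).card = n)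
    (h1 : (Finset.univ.filter fun m => h m = p).card = n) (hn2 : 2 * n ≤ M) (hn : M ≤ 3 * n) :
    ∃ (d : ℕ) (f : Fin M → SFun d) (xs ys : Vec d),
      ((∀ m, TwiceDifferentiable (f m) ∧ Smooth L (f m) ∧ StronglyConvexConcave μ (f m)) ∧
        StronglyConvexConcave μ (average f) ∧ Related δ f ∧ IsSolution (average f) xs ys) ∧
      xs ≠ 0 ∧ ys ≠ 0 ∧
      ∀ k ≤ K, ∀ x y : Vec d, IsOutput f W k x y → ‖ys‖ ^ 2 ≤ ‖y - ys‖ ^ 2 := by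
  have hM0 : (0 : ℝ) < M := by positivity
  have hn0 : 0 < n := by omega
  set θ : ℝ := n / M with hθ
  have hθ0 : 0 < θ := by positivity
  have hθ1 : θ ≤ 1 := by
    rw [hθ, div_le_one hM0]
    exact_mod_cast (by omega : n ≤ M)
  obtain ⟨ν, q, η, hν0, hq0, hq1, hη0, hq, hη2, hL, hνδ⟩ :=
    exists_hidden_parameters hμ hδ hμL hθ0 hθ1
  obtain ⟨N, hN⟩ : ∃ N, N = K + 1 := ⟨_, rfl⟩
  set P := splitOp h p (swapLap ν (swapEven N)) (swapLap ν (swapOdd N))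
  set Q : Fin M → Vec (2 * N + 2) →L[ℝ] Vec (2 * N + 2) := fun _ => lastCoupling N η with hQdef
  have hP : ∀ m, (P m : Vec (2 * N + 2) →ₗ[ℝ] Vec (2 * N + 2)).IsPositive :=
    isPositive_splitOp (isPositive_swapLap hν0.le (swapEven_symm N))
      (isPositive_swapLap hν0.le (swapOdd_symm N))
  have hPn : ∀ m, ‖P m‖ ≤ 2 * ν := splitOp_ind (R := fun T => ‖T‖ ≤ 2 * ν)
    (norm_swapLap_le hν0.le _) (norm_swapLap_le hν0.le _) (by simpa using hν0.le)
  have hPavg : opAverage P = θ • (swapLap ν (swapEven N) + swapLap ν (swapOdd N)) :=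
    opAverage_splitOp hp h0 h1 _ _
  have hQavg : opAverage Q = lastCoupling N η := opAverage_const (by omega) _
  set xs : Vec (2 * N + 2) := hiddenX N q with hxs
  set ys : Vec (2 * N + 2) := hiddenY N (η / μ * q ^ (2 * N + 1)) with hys
  set b : Vec (2 * N + 2) := μ • xs + opAverage P xs + opAverage Q ys
  have hb : ∀ i, i ≠ 0 → b i = 0 := fun i hi => by
    have := hidden_eq_x hμ hq hη2 hi
    simpa only [b, hPavg, hQavg] using this
  have hbm : b ∈ coordSubspace (fun i : Fin (2 * N + 2) => (i : ℕ)) 0 :=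
    single_mem_coordSubspace rfl hb
  have hylast : ys (Fin.last _) = η / μ * q ^ (2 * N + 1) := if_pos rfl
  have hyrest : ∀ i, i ≠ Fin.last _ → ys i = 0 := fun i hi => if_neg hi
  refine ⟨2 * N + 2, fun m => quad μ (P m) (Q m) b, xs, ys,
    quad_family_spec (by omega) hμ hδ.le hP (fun m => ?_) (fun m => ?_) (fun m => ?_) rfl ?_,
    fun h => ?_, fun h => ?_, ?_⟩
  · have h2 := hPn m
    have h3 : ‖Q m‖ ≤ η := norm_lastCoupling_le hη0.le
    linarith
  · refine (norm_sub_le _ _).trans ?_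
    have := norm_opAverage_le (by omega) hPn
    linarith [hPn m]
  · rw [hQavg, hQdef, sub_self, norm_zero]
    exact hδ.le
  · rw [hQavg]
    exact hidden_eq_y hμ η q
  · have : xs 0 = 1 := by simp [hxs, hiddenX]
    rw [h] at this
    simp at this
  · rw [h] at hylast
    have : 0 < η / μ * q ^ (2 * N + 1) := by positivity
    exact this.ne hylast
  · intro k hk x y hout
    have hkj : k < (K + 1) * p := by nlinarith
    have hy := (isOutput_mem hμ hp hW hh hP (splitChain_hidden ν η) hbm hkj hout).2
    rw [EuclideanSpace.real_norm_sq_eq, EuclideanSpace.real_norm_sq_eq]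
    refine Finset.sum_le_sum fun i _ => ?_
    by_cases hi : i = Fin.last _
    -- Outputs reach at most position `K + 1`, while the only nonzero coordinate of `ys` is at `2 *
    -- N + 1 = 2 * K + 3`.
    · have : y i = 0 := hy i (by change K + 1 < (i : ℕ); rw [hi, Fin.val_last]; omega)
      simp [this]
    · rw [hyrest i hi, zero_pow two_ne_zero]
      exact sq_nonneg _

end Hidden

end

end DistSPP

/-! ### The two regimes combined. -/

open DistSPP in
theorem mainTheorem4 :
    ∃ c c₀ : ℝ, 0 < c ∧ 0 < c₀ ∧
      ∀ L μ δ ρ : ℝ, 0 < μ → 0 < δ → μ < L → δ < L → 0 < ρ → ρ ≤ 1 → ∀ K : ℕ,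
        ∃ (d M : ℕ) (hM : 2 ≤ M) (f : Fin M → SFun d) (xs ys : Vec d)
          (G : SimpleGraph (Fin M)) (W : Matrix (Fin M) (Fin M) ℝ) (hW : IsGossip G W),
          (∀ m, TwiceDifferentiable (f m) ∧ Smooth L (f m) ∧ StronglyConvexConcave μ (f m)) ∧
          StronglyConvexConcave μ (average f) ∧
          Related δ f ∧
          IsSolution (average f) xs ys ∧ xs ≠ 0 ∧ ys ≠ 0 ∧
          G.Connected ∧ eigengap hM hW.symm = ρ ∧
          ∀ k ≤ K, ∀ x y : Vec d, IsOutput f W k x y →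
            ∀ ε : ℝ, 0 < ε → ‖x - xs‖ ^ 2 + ‖y - ys‖ ^ 2 ≤ ε →
              (ε ≤ c₀ * ‖ys‖ ^ 2 →
                c * ((1 / √ρ) * (1 + δ / μ) * Real.log (‖ys‖ ^ 2 / ε)) ≤ (k : ℝ)) ∧
              (2 * μ ≤ δ → ε ≤ c₀ * (‖xs‖ ^ 2 + ‖ys‖ ^ 2) →
                c * ((1 / √ρ) * (1 + δ / μ) * Real.log ((‖xs‖ ^ 2 + ‖ys‖ ^ 2) / ε)) ≤
                  (k : ℝ)) := by
  refine ⟨1 / 216, Real.exp (-40), by norm_num, Real.exp_pos _, ?_⟩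
  intro L μ δ ρ hμ hδ hμL hδL hρ hρ1 K
  obtain ⟨M, hM, G, W, hW, h, p, n, hG, hgap, hp, hpρ, hh, hlip, h0, h1, hn2, hn3⟩ :=
    exists_network hρ hρ1
  by_cases hc : 2 * μ ≤ δ
  · obtain ⟨d, f, xs, ys, ⟨hf, hav, hrel, hsol⟩, hxs, hys, hmain⟩ :=
      exists_bilinear_problem hμ hc hδL hρ K hM hp hpρ hh hlip h0 h1 hn3
    refine ⟨d, M, hM, f, xs, ys, G, W, hW, hf, hav, hrel, hsol, hxs, hys, hG, hgap, ?_⟩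
    intro k hk x y hout ε hε hdist
    exact ⟨hmain k hk x y hout ε hε hdist _ (by linarith [sq_nonneg ‖xs‖]),
      fun _ => hmain k hk x y hout ε hε hdist _ le_rfl⟩
  · obtain ⟨d, f, xs, ys, ⟨hf, hav, hrel, hsol⟩, hxs, hys, hmain⟩ :=
      exists_hidden_problem hμ hδ hμL K hM hp hh hlip h0 h1 hn2 hn3
    refine ⟨d, M, hM, f, xs, ys, G, W, hW, hf, hav, hrel, hsol, hxs, hys, hG, hgap, ?_⟩
    intro k hk x y hout ε hε hdist
    refine ⟨fun hεy => ?_, fun hc' => absurd hc' hc⟩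
    have hle := hmain k hk x y hout
    have hy0 : 0 < ‖ys‖ ^ 2 := by positivity
    -- The error is at least `‖ys‖ ^ 2`, which contradicts `hεy`; the claim holds vacuously.
    have : Real.exp (-40) * ‖ys‖ ^ 2 < 1 * ‖ys‖ ^ 2 :=
      mul_lt_mul_of_pos_right (by simp) hy0
    linarith [sq_nonneg ‖x - xs‖]
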